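/- Let \(\mathbb{Q}\mathbb{U}\) be the rational Urysohn metric space, i.e. the (unique up to isometry) countable metric space with only rational distances such that, whenever \(Y = X\cup\{y\}\) is a finite metric space with only rational distances, every isometric embedding of \(X\) into \(\mathbb{Q}\mathbb{U}\) extends to an isometric embedding of \(Y\) into \(\mathbb{Q}\mathbb{U}\). Let \(\mathrm{Isom}(\mathbb{Q}\mathbb{U})\) be the group of isometries of \(\mathbb{Q}\mathbb{U}\) onto itself, with the permutation group topology, whose basic open sets are \(\{g : g(x_i)=f(x_i),\ i\le m\}\) for \(f\in \mathrm{Isom}(\mathbb{Q}\mathbb{U})\) and \(x_1,\dots,x_m\in\mathbb{Q}\mathbb{U}\). Call \(f\in \mathrm{Isom}(\mathbb{Q}\mathbb{U})\) generic if its conjugacy class is comeagre in \(\mathrm{Isom}(\mathbb{Q}\mathbb{U})\). Generic isometries of \(\mathbb{Q}\mathbb{U}\) exist. Moreover, for every generic \(f\in \mathrm{Isom}(\mathbb{Q}\mathbb{U})\) and every integer \(n\neq 0\), there is \(g\in \mathrm{Isom}(\mathbb{Q}\mathbb{U})\) with \(g^n=f\), and \(f\) is conjugate to \(f^n\) in \(\mathrm{Isom}(\mathbb{Q}\mathbb{U})\).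 -/

import Mathlib

/-- A metric space `X` is (a copy of) the rational Urysohn metric space: it is countable, all its
distances are rational, and every isometric embedding `φ` of a finite metric space `Y ∖ {y}` into
`X`, where `Y` is finite with rational distances only, extends to an isometric embedding of `Y`. -/
structure IsRationalUrysohn (X : Type*) [MetricSpace X] : Prop where
  countable : Countable X
  rational : ∀ x x' : X, ∃ q : ℚ, dist x x' = (q : ℝ)
  extension : ∀ (Y : Type) [MetricSpace Y] [Finite Y],
    (∀ a b : Y, ∃ q : ℚ, dist a b = (q : ℝ)) →
    ∀ (y : Y) (φ : {a : Y // a ≠ y} → X), Isometry φ →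
      ∃ ψ : Y → X, Isometry ψ ∧ ∀ a : {a : Y // a ≠ y}, ψ a = φ a

/-- The permutation group topology on the group `X ≃ᵢ X` of isometries of `X` onto itself: its
basic open sets are `{g | ∀ x ∈ A, g x = f x}` for `f` an isometry and `A ⊆ X` finite. -/
@[reducible] def permutationTopology (X : Type*) [MetricSpace X] : TopologicalSpace (X ≃ᵢ X) :=
  TopologicalSpace.generateFrom
    {U | ∃ (f : X ≃ᵢ X) (A : Finset X), U = {g : X ≃ᵢ X | ∀ x ∈ A, g x = f x}}

/-- An isometry `f` of `X` onto itself is generic if its conjugacy class is comeagre in the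
isometry group of `X` for the permutation group topology. -/
def IsGenericIsometry {X : Type*} [MetricSpace X] (f : X ≃ᵢ X) : Prop :=
  {g : X ≃ᵢ X | IsConj f g} ∈ @residual (X ≃ᵢ X) (permutationTopology X)

/-! The rational Urysohn space exists: a metric on `ℕ` is built one point at a time. -/

namespace RationalUrysohnConstruction

/-- `D` restricts to a (rational) metric on `{0, …, n - 1}`. -/
structure MetricOn (n : ℕ) (D : ℕ → ℕ → ℚ) : Prop where
  self : ∀ i < n, D i i = 0
  pos : ∀ i < n, ∀ j < n, i ≠ j → 0 < D i j
  symm : ∀ i < n, ∀ j < n, D i j = D j i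
  tri : ∀ i < n, ∀ j < n, ∀ k < n, D i k ≤ D i j + D j k

/-- `g` is the distance function to a new point, over the points satisfying `P`. -/
def Kat (P : ℕ → Prop) (D : ℕ → ℕ → ℚ) (g : ℕ → ℚ) : Prop :=
  ∀ i, P i → 0 < g i ∧ ∀ j, P j → g i ≤ g j + D i j ∧ D i j ≤ g i + g j

theorem kat_extend_aux {n : ℕ} {D : ℕ → ℕ → ℚ} (hD : MetricOn n D) (S : Finset ℕ)
    (hS : ∀ i ∈ S, i < n) (hne : S.Nonempty) (f : ℕ → ℚ) (hf : Kat (· ∈ S) D f) :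
    ∃ g, Kat (· < n) D g ∧ ∀ i ∈ S, g i = f i := by
  let g : ℕ → ℚ := fun j => S.inf' hne (fun a => f a + D a j)
  have hle : ∀ j, ∀ a ∈ S, g j ≤ f a + D a j := fun j a ha =>
    Finset.inf'_le (fun a => f a + D a j) ha
  have hat : ∀ j, ∃ a ∈ S, g j = f a + D a j := fun j =>
    Finset.exists_mem_eq_inf' hne (fun a => f a + D a j)
  have hnn : ∀ i < n, ∀ j < n, 0 ≤ D i j := by
    intro i hi j hj
    by_cases h : i = j
    · subst h
      exact (hD.self i hi).ge
    · exact (hD.pos i hi j hj h).le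
  refine ⟨g, ?_, ?_⟩
  · intro i hi
    obtain ⟨a, ha, hia⟩ := hat i
    refine ⟨?_, ?_⟩
    · have h1 := (hf a ha).1
      have h2 := hnn a (hS a ha) i hi
      linarith
    · intro j hj
      obtain ⟨b, hb, hjb⟩ := hat j
      constructor
      · have h1 := hle i b hb
        have h2 := hD.tri b (hS b hb) j hj i hi
        have h3 := hD.symm i hi j hj
        linarith
      · have h1 := ((hf a ha).2 b hb).2
        have h2 := hD.tri i hi a (hS a ha) j hj
        have h3 := hD.tri a (hS a ha) b (hS b hb) j hj
        have h4 := hD.symm i hi a (hS a ha)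
        linarith
  · intro i hi
    obtain ⟨a, ha, hia⟩ := hat i
    have h1 := hle i i hi
    have h2 := ((hf i hi).2 a ha).1
    have h3 := hD.symm i (hS i hi) a (hS a ha)
    have h4 := hD.self i (hS i hi)
    apply le_antisymm <;> linarith

theorem kat_extend {n : ℕ} {D : ℕ → ℕ → ℚ} (hD : MetricOn n D) (S : Finset ℕ)
    (hS : ∀ i ∈ S, i < n) (f : ℕ → ℚ) (hf : Kat (· ∈ S) D f) :
    ∃ g, Kat (· < n) D g ∧ ∀ i ∈ S, g i = f i := by
  rcases S.eq_empty_or_nonempty with rfl | hne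
  · rcases Nat.eq_zero_or_pos n with rfl | hn
    · exact ⟨fun _ => 0, fun i hi => absurd hi (Nat.not_lt_zero i), by simp⟩
    · obtain ⟨g, hg, -⟩ := kat_extend_aux hD {0} (by simpa using hn) (by simp) (fun _ => 1)
        (by
          intro i hi
          refine ⟨one_pos, fun j hj => ?_⟩
          rw [Finset.mem_singleton] at hi hj
          subst hi
          subst hj
          rw [hD.self 0 hn]
          norm_num)
      exact ⟨g, hg, by simp⟩
  · exact kat_extend_aux hD S hS hne f hf

theorem step {n : ℕ} {D : ℕ → ℕ → ℚ} (hD : MetricOn n D) (f : ℕ →₀ ℚ) :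
    ∃ D' : ℕ → ℕ → ℚ, MetricOn (n + 1) D' ∧ (∀ i < n, ∀ j < n, D' i j = D i j) ∧
      ((∀ i ∈ f.support, i < n) → Kat (· ∈ f.support) D f →
        ∀ i ∈ f.support, D' n i = f i) := by
  obtain ⟨g, hg, hgf⟩ : ∃ g, Kat (· < n) D g ∧ ((∀ i ∈ f.support, i < n) →
      Kat (· ∈ f.support) D f → ∀ i ∈ f.support, g i = f i) := by
    by_cases h : (∀ i ∈ f.support, i < n) ∧ Kat (· ∈ f.support) D f
    · obtain ⟨g, hg, h'⟩ := kat_extend hD f.support h.1 f h.2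
      exact ⟨g, hg, fun _ _ => h'⟩
    · obtain ⟨g, hg, -⟩ := kat_extend hD ∅ (by simp) (fun _ => 0)
        (fun i hi => absurd hi (Finset.notMem_empty i))
      exact ⟨g, hg, fun h1 h2 => absurd ⟨h1, h2⟩ h⟩
  let D' : ℕ → ℕ → ℚ := fun i j =>
    if i = n then (if j = n then 0 else g j) else if j = n then g i else D i j
  have e1 : D' n n = 0 := by simp [D']
  have e2 : ∀ j < n, D' n j = g j := fun j hj => by simp [D', hj.ne]
  have e3 : ∀ j < n, D' j n = g j := fun j hj => by simp [D', hj.ne]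
  have e4 : ∀ i < n, ∀ j < n, D' i j = D i j := fun i hi j hj => by simp [D', hi.ne, hj.ne]
  have hc : ∀ i, i < n + 1 → i < n ∨ i = n := fun i hi => by omega
  refine ⟨D', ⟨?_, ?_, ?_, ?_⟩, e4, fun h1 h2 i hi => by rw [e2 i (h1 i hi), hgf h1 h2 i hi]⟩
  · intro i hi
    rcases hc i hi with hi | rfl
    · rw [e4 i hi i hi, hD.self i hi]
    · exact e1
  · intro i hi j hj hij
    rcases hc i hi with hi | rfl <;> rcases hc j hj with hj | rfl
    · rw [e4 i hi j hj]
      exact hD.pos i hi j hj hij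
    · rw [e3 i hi]
      exact (hg i hi).1
    · rw [e2 j hj]
      exact (hg j hj).1
    · exact absurd rfl hij
  · intro i hi j hj
    rcases hc i hi with hi | rfl <;> rcases hc j hj with hj | rfl
    · rw [e4 i hi j hj, e4 j hj i hi, hD.symm i hi j hj]
    · rw [e3 i hi, e2 i hi]
    · rw [e3 j hj, e2 j hj]
    · rfl
  · intro i hi j hj k hk
    rcases hc i hi with hi | rfl <;> rcases hc j hj with hj | rfl <;>
      rcases hc k hk with hk | rfl
    · rw [e4 i hi k hk, e4 i hi j hj, e4 j hj k hk]
      exact hD.tri i hi j hj k hk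
    · rw [e3 i hi, e4 i hi j hj, e3 j hj]
      linarith [((hg i hi).2 j hj).1]
    · rw [e4 i hi k hk, e3 i hi, e2 k hk]
      exact ((hg i hi).2 k hk).2
    · rw [e1]
      linarith
    · rw [e2 k hk, e2 j hj, e4 j hj k hk, hD.symm j hj k hk]
      linarith [((hg k hk).2 j hj).1]
    · rw [e1, e2 j hj, e3 j hj]
      linarith [(hg j hj).1]
    · rw [e1]
      linarith
    · rw [e1]
      norm_num

/-- A rational metric on `ℕ` in which every admissible finite list of distances is realised. -/
theorem exists_dist : ∃ d : ℕ → ℕ → ℚ, (∀ n, MetricOn n d) ∧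
    ∀ f : ℕ →₀ ℚ, Kat (· ∈ f.support) d f → ∃ n, ∀ i ∈ f.support, d n i = f i := by
  classical
  obtain ⟨s, hs⟩ := exists_surjective_nat (ℕ →₀ ℚ)
  let F : (n : ℕ) → {D : ℕ → ℕ → ℚ // MetricOn n D} := fun n =>
    Nat.rec (motive := fun n => {D : ℕ → ℕ → ℚ // MetricOn n D})
      ⟨fun _ _ => 0, ⟨by simp, by simp, by simp, by simp⟩⟩
      (fun n D => ⟨(step D.2 (s (Nat.unpair n).1)).choose,
        (step D.2 (s (Nat.unpair n).1)).choose_spec.1⟩) n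
  have hF : ∀ n, (∀ i < n, ∀ j < n, (F (n + 1)).1 i j = (F n).1 i j) ∧
      ((∀ i ∈ (s (Nat.unpair n).1).support, i < n) →
        Kat (· ∈ (s (Nat.unpair n).1).support) (F n).1 (s (Nat.unpair n).1) →
        ∀ i ∈ (s (Nat.unpair n).1).support, (F (n + 1)).1 n i = s (Nat.unpair n).1 i) :=
    fun n => (step (F n).2 (s (Nat.unpair n).1)).choose_spec.2
  have hmono : ∀ n k, ∀ i < n, ∀ j < n, (F (n + k)).1 i j = (F n).1 i j := by
    intro n k
    induction k with
    | zero => intros; rfl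
    | succ k ih =>
      intro i hi j hj
      rw [← ih i hi j hj]
      exact (hF (n + k)).1 i (by omega) j (by omega)
  let d : ℕ → ℕ → ℚ := fun i j => (F (max i j + 1)).1 i j
  have hd : ∀ n, ∀ i < n, ∀ j < n, d i j = (F n).1 i j := by
    intro n i hi j hj
    obtain ⟨k, rfl⟩ : ∃ k, n = max i j + 1 + k := ⟨n - (max i j + 1), by omega⟩
    exact (hmono _ k i (by omega) j (by omega)).symm
  refine ⟨d, fun n => ⟨?_, ?_, ?_, ?_⟩, ?_⟩
  · intro i hi
    rw [hd n i hi i hi]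
    exact (F n).2.self i hi
  · intro i hi j hj h
    rw [hd n i hi j hj]
    exact (F n).2.pos i hi j hj h
  · intro i hi j hj
    rw [hd n i hi j hj, hd n j hj i hi]
    exact (F n).2.symm i hi j hj
  · intro i hi j hj k hk
    rw [hd n i hi j hj, hd n j hj k hk, hd n i hi k hk]
    exact (F n).2.tri i hi j hj k hk
  · intro f hf
    obtain ⟨c, rfl⟩ := hs f
    let N := (s c).support.sup id + 1
    have hN : ∀ i ∈ (s c).support, i < Nat.pair c N := by
      intro i hi
      have h1 : i ≤ (s c).support.sup id := Finset.le_sup (f := id) hi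
      have h2 : N ≤ Nat.pair c N := Nat.right_le_pair c N
      omega
    refine ⟨Nat.pair c N, fun i hi => ?_⟩
    have h := (hF (Nat.pair c N)).2
    simp only [Nat.unpair_pair] at h
    rw [hd (Nat.pair c N + 1) _ (by omega) i (by have := hN i hi; omega)]
    refine h hN ?_ i hi
    intro a ha
    refine ⟨(hf a ha).1, fun b hb => ?_⟩
    rw [← hd _ a (hN a ha) b (hN b hb)]
    exact (hf a ha).2 b hb

end RationalUrysohnConstruction

open RationalUrysohnConstruction in
/-- There is a rational Urysohn metric space. -/
theorem exists_isRationalUrysohn : ∃ (X : Type) (_ : MetricSpace X), IsRationalUrysohn X := by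
  classical
  obtain ⟨d, hd, hext⟩ := exists_dist
  have dself : ∀ i, d i i = 0 := fun i => (hd (i + 1)).self i (by omega)
  have dpos : ∀ i j, i ≠ j → 0 < d i j := fun i j h =>
    (hd (i + j + 1)).pos i (by omega) j (by omega) h
  have dsymm : ∀ i j, d i j = d j i := fun i j =>
    (hd (i + j + 1)).symm i (by omega) j (by omega)
  have dtri : ∀ i j k, d i k ≤ d i j + d j k := fun i j k =>
    (hd (i + j + k + 1)).tri i (by omega) j (by omega) k (by omega)
  let M : MetricSpace ℕ :=
    { dist := fun i j => (d i j : ℝ)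
      dist_self := fun i => by exact_mod_cast dself i
      dist_comm := fun i j => by exact_mod_cast dsymm i j
      dist_triangle := fun i j k => by exact_mod_cast dtri i j k
      eq_of_dist_eq_zero := by
        intro i j h
        by_contra hne
        have h1 := dpos i j hne
        have h2 : d i j = 0 := by exact_mod_cast h
        exact h1.ne' h2 }
  have hdist : ∀ i j : ℕ, @dist ℕ M.toDist i j = (d i j : ℝ) := fun _ _ => rfl
  refine ⟨ℕ, M, @IsRationalUrysohn.mk ℕ M inferInstance (fun i j => ⟨d i j, rfl⟩) ?_⟩
  intro Y mY fY hY y φ hφ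
  have hφd : ∀ a b, (d (φ a) (φ b) : ℝ) = dist a.1 b.1 := fun a b => hφ.dist_eq a b
  choose q hq using hY
  have hinj : Function.Injective φ := hφ.injective
  have : Fintype Y := Fintype.ofFinite Y
  let f : ℕ →₀ ℚ := Finsupp.onFinset (Finset.univ.image φ)
    (fun i => if h : ∃ a, φ a = i then q y h.choose.1 else 0) (by
      intro i hi
      by_contra hc
      apply hi
      rw [dif_neg]
      rintro ⟨a, rfl⟩
      exact hc (Finset.mem_image_of_mem φ (Finset.mem_univ a)))
  have hf : ∀ a, f (φ a) = q y a.1 := by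
    intro a
    have h : ∃ b, φ b = φ a := ⟨a, rfl⟩
    have h' : h.choose = a := hinj h.choose_spec
    simp only [f, Finsupp.onFinset_apply]
    rw [dif_pos h, h']
  have hpos : ∀ a : {a : Y // a ≠ y}, 0 < q y a.1 := by
    intro a
    have : 0 < dist y a.1 := dist_pos.2 a.2.symm
    rw [hq] at this
    exact_mod_cast this
  have hsupp : ∀ i, i ∈ f.support ↔ ∃ a, φ a = i := by
    intro i
    constructor
    · intro hi
      have := Finsupp.support_onFinset_subset hi
      simpa using this
    · rintro ⟨a, rfl⟩
      rw [Finsupp.mem_support_iff, hf]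
      exact (hpos a).ne'
  obtain ⟨n, hn⟩ := hext f (by
    intro i hi
    obtain ⟨a, rfl⟩ := (hsupp i).1 hi
    rw [hf]
    refine ⟨hpos a, fun j hj => ?_⟩
    obtain ⟨b, rfl⟩ := (hsupp j).1 hj
    rw [hf]
    have h1 := dist_triangle y b.1 a.1
    have h2 := dist_triangle_left a.1 b.1 y
    rw [dist_comm b.1 a.1, ← hφd a b, hq, hq] at h1
    rw [← hφd a b, hq, hq] at h2
    exact ⟨by exact_mod_cast h1, by exact_mod_cast h2⟩)
  have hn' : ∀ a, (d n (φ a) : ℝ) = dist y a.1 := by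
    intro a
    rw [hn _ ((hsupp _).2 ⟨a, rfl⟩), hf, ← hq]
  let ψ : Y → ℕ := fun a => if h : a = y then n else φ ⟨a, h⟩
  have hψy : ψ y = n := dif_pos rfl
  have hψ : ∀ a (h : a ≠ y), ψ a = φ ⟨a, h⟩ := fun a h => dif_neg h
  refine ⟨ψ, ?_, fun a => hψ a.1 a.2⟩
  refine @Isometry.of_dist_eq Y ℕ _ M.toPseudoMetricSpace ψ ?_
  intro a b
  rw [hdist]
  by_cases ha : a = y <;> by_cases hb : b = y
  · subst ha
    subst hb
    rw [dself, dist_self]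
    norm_num
  · subst ha
    rw [hψy, hψ b hb, hn']
  · subst hb
    rw [hψy, hψ a ha, dsymm, hn', dist_comm]
  · rw [hψ a ha, hψ b hb, hφd]

/-! Call an isometry rich (`IsRichIsometry`) if its orbits are finite and, whenever some isometry
`g` with finite invariant sets `A ⊆ B` agrees with it on `A`, it contains a copy of `g` on `B` over
`A`. Rich isometries form a comeagre set, any two are conjugate by back-and-forth, and nonzero
powers of rich isometries are rich. The topology is Baire, so a comeagre conjugacy class contains a
rich `h`. If `f` is generic, then `f` is conjugate to `h`, hence to `h ^ n`, hence to `f ^ n`;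
conjugating `f` back turns this into an `n`-th root.

Three finite constructions carry the argument. `exists_finite_extension` closes up a finite part of
an isometry to a finite invariant set and makes finite orbits dense. `amalgamate` glues two finite
actions over a common part and makes each extension property dense. `exists_root` extracts an `n`-th
root of a finite action extending a given root on a part, and passes richness to powers.

All three rest on the Kuratowski embedding. A point is encoded by its prospective distances to a
finite index set on which a permutation acts. If these functions are rational, 1-Lipschitz in the
point and correct on the original points, the sup distance is a rational metric extending the given
one, and permuting coordinates is an isometry of it. `realize` copies such a configuration, with its
permutation, into `X`. -/

/-! ### Extension of finite partial isometric maps -/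

/-- The defining property only speaks of `Y : Type`; moving the metric to `Fin n` frees the
universe. -/
theorem IsRationalUrysohn.extension_univ {X : Type*} [MetricSpace X] (hX : IsRationalUrysohn X)
    {Y : Type*} [MetricSpace Y] [Finite Y] (hY : ∀ a b : Y, ∃ q : ℚ, dist a b = (q : ℝ))
    (y : Y) (φ : {a : Y // a ≠ y} → X) (hφ : Isometry φ) :
    ∃ ψ : Y → X, Isometry ψ ∧ ∀ a : {a : Y // a ≠ y}, ψ a = φ a := by
  obtain ⟨n, ⟨e⟩⟩ := Finite.exists_equiv_fin Y
  let _ : MetricSpace (Fin n) := MetricSpace.induced e.symm e.symm.injective inferInstance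
  have he : ∀ a b : Fin n, dist a b = dist (e.symm a) (e.symm b) := fun _ _ => rfl
  obtain ⟨ψ, hψ, h⟩ := hX.extension (Fin n) (fun a b => hY _ _) (e y)
    (fun a => φ ⟨e.symm a.1, fun h => a.2 ((e.symm_apply_eq).1 h)⟩) (by
      refine Isometry.of_dist_eq fun a b => ?_
      rw [hφ.dist_eq]
      rfl)
  refine ⟨fun a => ψ (e a), Isometry.of_dist_eq fun a b => ?_, fun a => ?_⟩
  · rw [hψ.dist_eq, he, e.symm_apply_apply, e.symm_apply_apply]
  · have := h ⟨e a.1, fun h => a.2 (e.injective h)⟩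
    simpa using this

theorem IsRationalUrysohn.nonempty {X : Type*} [MetricSpace X] (hX : IsRationalUrysohn X) :
    Nonempty X :=
  let ⟨ψ, _⟩ := hX.extension Unit (fun a b => ⟨0, by simp⟩) () (fun a => (a.2 rfl).elim)
    fun a => (a.2 rfl).elim
  ⟨ψ ()⟩

/-- One-point extension of a finite partial isometric map. -/
theorem IsRationalUrysohn.exists_point {X : Type*} [MetricSpace X] (hX : IsRationalUrysohn X)
    {Z : Type*} [MetricSpace Z] (C : Finset Z) (p : Z → X)
    (hp : ∀ a ∈ C, ∀ b ∈ C, dist (p a) (p b) = dist a b) (z : Z)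
    (hz : ∀ a ∈ C, ∃ q : ℚ, dist z a = (q : ℝ)) :
    ∃ x : X, ∀ a ∈ C, dist x (p a) = dist z a := by
  classical
  by_cases hzC : z ∈ C
  · exact ⟨p z, fun a ha => hp z hzC a ha⟩
  let Y := {a : Z // a ∈ insert z C}
  have hmem : ∀ a : Y, a ≠ ⟨z, Finset.mem_insert_self z C⟩ → a.1 ∈ C := fun a ha =>
    (Finset.mem_insert.1 a.2).resolve_left fun h => ha (Subtype.ext h)
  obtain ⟨ψ, hψ, h⟩ := hX.extension_univ (Y := Y) (by
      rintro ⟨a, ha⟩ ⟨b, hb⟩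
      change ∃ q : ℚ, dist a b = (q : ℝ)
      rcases Finset.mem_insert.1 ha with rfl | h <;> rcases Finset.mem_insert.1 hb with rfl | h'
      · exact ⟨0, by simp⟩
      · exact hz b h'
      · rw [dist_comm]
        exact hz a h
      · rw [← hp a h b h']
        exact hX.rational _ _)
    ⟨z, Finset.mem_insert_self z C⟩ (fun a => p a.1.1) (by
      refine Isometry.of_dist_eq fun a b => ?_
      rw [hp _ (hmem _ a.2) _ (hmem _ b.2)]
      rfl)
  refine ⟨ψ ⟨z, Finset.mem_insert_self z C⟩, fun a ha => ?_⟩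
  have := h ⟨⟨a, Finset.mem_insert_of_mem ha⟩, fun h => hzC (by
    have := congrArg Subtype.val h
    simp only at this
    exact this ▸ ha)⟩
  rw [← this, hψ.dist_eq]
  rfl

/-- A finite partial isometric map extends to any larger finite rational set. -/
theorem IsRationalUrysohn.exists_extend {X : Type*} [MetricSpace X] (hX : IsRationalUrysohn X)
    {Z : Type*} [MetricSpace Z] (C D : Finset Z) (p : Z → X)
    (hp : ∀ a ∈ C, ∀ b ∈ C, dist (p a) (p b) = dist a b)
    (hD : ∀ a ∈ D, ∀ b, b ∈ C ∨ b ∈ D → ∃ q : ℚ, dist a b = (q : ℝ)) :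
    ∃ p' : Z → X, (∀ a ∈ C, p' a = p a) ∧
      ∀ a, a ∈ C ∨ a ∈ D → ∀ b, b ∈ C ∨ b ∈ D → dist (p' a) (p' b) = dist a b := by
  classical
  induction D using Finset.induction_on with
  | empty => exact ⟨p, fun _ _ => rfl, by simpa using hp⟩
  | insert z D hzD ih =>
    obtain ⟨p', h1, h2⟩ := ih fun a ha b hb => hD a (Finset.mem_insert_of_mem ha) b
      (hb.imp id Finset.mem_insert_of_mem)
    by_cases hz : z ∈ C
    · refine ⟨p', h1, fun a ha b hb => h2 a ?_ b ?_⟩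
      · rcases ha with ha | ha
        · exact Or.inl ha
        · rcases Finset.mem_insert.1 ha with rfl | ha
          exacts [Or.inl hz, Or.inr ha]
      · rcases hb with hb | hb
        · exact Or.inl hb
        · rcases Finset.mem_insert.1 hb with rfl | hb
          exacts [Or.inl hz, Or.inr hb]
    have hne : ∀ a, a ∈ C ∨ a ∈ D → a ≠ z := by
      rintro a ha rfl
      tauto
    obtain ⟨x, hx⟩ := hX.exists_point (C ∪ D) p' (fun a ha b hb =>
      h2 a (Finset.mem_union.1 ha) b (Finset.mem_union.1 hb)) z (fun a ha =>
      hD z (Finset.mem_insert_self z D) a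
        ((Finset.mem_union.1 ha).imp id Finset.mem_insert_of_mem))
    have hx' : ∀ a, a ∈ C ∨ a ∈ D → dist x (p' a) = dist z a := fun a ha =>
      hx a (Finset.mem_union.2 ha)
    have hcase : ∀ a, a ∈ C ∨ a ∈ insert z D → a = z ∨ (a ∈ C ∨ a ∈ D) := by
      intro a ha
      rw [Finset.mem_insert] at ha
      tauto
    refine ⟨Function.update p' z x, fun a ha => ?_, fun a ha b hb => ?_⟩
    · rw [Function.update_of_ne (hne a (Or.inl ha)), h1 a ha]
    · rcases hcase a ha with rfl | h <;> rcases hcase b hb with rfl | h'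
      · simp
      · rw [Function.update_self, Function.update_of_ne (hne b h'), hx' b h']
      · rw [Function.update_self, Function.update_of_ne (hne a h), dist_comm, hx' a h, dist_comm]
      · rw [Function.update_of_ne (hne a h), Function.update_of_ne (hne b h'), h2 a h b h']

/-! ### Back-and-forth and ultrahomogeneity -/

/-- A relation preserving distances. -/
def IsIsometricRel {X : Type*} [MetricSpace X] (R : Set (X × X)) : Prop :=
  ∀ r ∈ R, ∀ s ∈ R, dist r.1 s.1 = dist r.2 s.2

/-- Back-and-forth: a family of finite partial isometries of a countable space with the forth and
the back property yields total isometries. -/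
theorem exists_isometryEquiv_of_backAndForth {X : Type*} [MetricSpace X] [Countable X]
    (P : Finset (X × X) → Prop) (hP : ∀ R, P R → IsIsometricRel (R : Set (X × X)))
    (forth : ∀ R, P R → ∀ x, ∃ R', P R' ∧ R ⊆ R' ∧ ∃ y, (x, y) ∈ R')
    (back : ∀ R, P R → ∀ y, ∃ R', P R' ∧ R ⊆ R' ∧ ∃ x, (x, y) ∈ R')
    (R₀ : Finset (X × X)) (h₀ : P R₀) :
    ∃ F : X ≃ᵢ X, (∀ r ∈ R₀, F r.1 = r.2) ∧
      ∀ x, ∃ R, P R ∧ (x, F x) ∈ R ∧ ∀ r ∈ R, F r.1 = r.2 := by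
  classical
  have : Encodable X := Encodable.ofCountable X
  let Q := {R : Finset (X × X) // P R}
  -- Rasiowa–Sikorski: the union of an ideal meeting these countably many cofinal sets is the graph
  -- of a total, surjective isometry.
  let 𝒟 : X ⊕ X → Order.Cofinal Q := Sum.elim
    (fun x => ⟨{R | ∃ y, (x, y) ∈ R.1}, fun R => by
      obtain ⟨R', h1, h2, h3⟩ := forth R.1 R.2 x
      exact ⟨⟨R', h1⟩, h3, h2⟩⟩)
    (fun y => ⟨{R | ∃ x, (x, y) ∈ R.1}, fun R => by
      obtain ⟨R', h1, h2, h3⟩ := back R.1 R.2 y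
      exact ⟨⟨R', h1⟩, h3, h2⟩⟩)
  let I := Order.idealOfCofinals (⟨R₀, h₀⟩ : Q) 𝒟
  have hI : ∀ R ∈ I, ∀ S ∈ I, ∀ r ∈ R.1, ∀ s ∈ S.1, dist r.1 s.1 = dist r.2 s.2 := by
    intro R hR S hS r hr s hs
    obtain ⟨T, -, h1, h2⟩ := I.directed R hR S hS
    exact hP T.1 T.2 r (h1 hr) s (h2 hs)
  have hF : ∀ x, ∃ y, ∃ R ∈ I, (x, y) ∈ R.1 := by
    intro x
    obtain ⟨R, ⟨y, hy⟩, hR⟩ := Order.cofinal_meets_idealOfCofinals (⟨R₀, h₀⟩ : Q) 𝒟 (Sum.inl x)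
    exact ⟨y, R, hR, hy⟩
  have hG : ∀ y, ∃ x, ∃ R ∈ I, (x, y) ∈ R.1 := by
    intro y
    obtain ⟨R, ⟨x, hx⟩, hR⟩ := Order.cofinal_meets_idealOfCofinals (⟨R₀, h₀⟩ : Q) 𝒟 (Sum.inr y)
    exact ⟨x, R, hR, hx⟩
  choose F hF using hF
  choose G hG using hG
  have huniq : ∀ R ∈ I, ∀ r ∈ R.1, F r.1 = r.2 := by
    intro R hR r hr
    obtain ⟨S, hS, h⟩ := hF r.1
    have := hI S hS R hR _ h r hr
    rw [dist_self] at this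
    exact dist_eq_zero.1 this.symm
  let E : X ≃ᵢ X := IsometryEquiv.mk' F G
    (fun y => by
      obtain ⟨R, hR, h⟩ := hG y
      exact huniq R hR _ h)
    (Isometry.of_dist_eq fun x y => by
      obtain ⟨R, hR, h⟩ := hF x
      obtain ⟨S, hS, h'⟩ := hF y
      exact (hI R hR S hS _ h _ h').symm)
  refine ⟨E, huniq ⟨R₀, h₀⟩ (Order.mem_idealOfCofinals _ _), fun x => ?_⟩
  obtain ⟨R, hR, h⟩ := hF x
  exact ⟨R.1, R.2, h, huniq R hR⟩

theorem IsRationalUrysohn.exists_forth {X : Type*} [MetricSpace X] (hX : IsRationalUrysohn X)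
    (R : Finset (X × X)) (hR : IsIsometricRel (R : Set (X × X))) (x : X) :
    ∃ y, ∀ r ∈ R, dist x r.1 = dist y r.2 := by
  classical
  have : Nonempty X := ⟨x⟩
  have hp : ∀ a, ∃ b, (∃ b, (a, b) ∈ R) → (a, b) ∈ R := fun a => by
    by_cases h : ∃ b, (a, b) ∈ R
    · exact ⟨h.choose, fun _ => h.choose_spec⟩
    · exact ⟨x, fun h' => absurd h' h⟩
  choose p hp using hp
  -- Preservation of the distance 0 makes `R` single-valued.
  have hpR : ∀ r ∈ R, p r.1 = r.2 := by
    intro r hr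
    have := hR _ (hp r.1 ⟨r.2, hr⟩) r hr
    rw [dist_self] at this
    exact dist_eq_zero.1 this.symm
  obtain ⟨y, hy⟩ := hX.exists_point (R.image Prod.fst) p (by
      intro a ha b hb
      obtain ⟨r, hr, rfl⟩ := Finset.mem_image.1 ha
      obtain ⟨s, hs, rfl⟩ := Finset.mem_image.1 hb
      rw [hpR r hr, hpR s hs]
      exact (hR r hr s hs).symm) x (fun a _ => hX.rational _ _)
  exact ⟨y, fun r hr => by rw [← hpR r hr, hy _ (Finset.mem_image_of_mem _ hr)]⟩

theorem IsIsometricRel.insert {X : Type*} [MetricSpace X] {R : Set (X × X)}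
    (hR : IsIsometricRel R) {t : X × X} (ht : ∀ r ∈ R, dist t.1 r.1 = dist t.2 r.2) :
    IsIsometricRel (insert t R) := by
  rintro r (rfl | hr) s (rfl | hs)
  · simp
  · exact ht s hs
  · rw [dist_comm, ht r hr, dist_comm]
  · exact hR r hr s hs

/-- Ultrahomogeneity of the rational Urysohn space. -/
theorem IsRationalUrysohn.homogeneous_rel {X : Type*} [MetricSpace X] (hX : IsRationalUrysohn X)
    (R : Finset (X × X)) (hR : IsIsometricRel (R : Set (X × X))) :
    ∃ F : X ≃ᵢ X, ∀ r ∈ R, F r.1 = r.2 := by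
  classical
  have := hX.countable
  obtain ⟨F, hF, -⟩ := exists_isometryEquiv_of_backAndForth
    (fun R => IsIsometricRel (R : Set (X × X))) (fun _ h => h)
    (by
      intro R hR x
      obtain ⟨y, hy⟩ := hX.exists_forth R hR x
      refine ⟨insert (x, y) R, ?_, Finset.subset_insert _ _, y, Finset.mem_insert_self _ _⟩
      rw [Finset.coe_insert]
      exact hR.insert hy)
    (by
      intro R hR y
      obtain ⟨x, hx⟩ := hX.exists_forth (R.image Prod.swap) (by
        intro r hr s hs
        obtain ⟨r, hr', rfl⟩ := Finset.mem_image.1 hr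
        obtain ⟨s, hs', rfl⟩ := Finset.mem_image.1 hs
        exact (hR r hr' s hs').symm) y
      refine ⟨insert (x, y) R, ?_, Finset.subset_insert _ _, x, Finset.mem_insert_self _ _⟩
      rw [Finset.coe_insert]
      exact hR.insert fun r hr => (hx r.swap (Finset.mem_image_of_mem _ hr)).symm)
    R hR
  exact ⟨F, hF⟩

theorem IsRationalUrysohn.homogeneous {X : Type*} [MetricSpace X] (hX : IsRationalUrysohn X)
    (C : Finset X) (p : X → X) (hp : ∀ a ∈ C, ∀ b ∈ C, dist (p a) (p b) = dist a b) :
    ∃ F : X ≃ᵢ X, ∀ a ∈ C, F a = p a := by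
  classical
  obtain ⟨F, hF⟩ := hX.homogeneous_rel (C.image fun a => (a, p a)) (by
    intro r hr s hs
    obtain ⟨a, ha, rfl⟩ := Finset.mem_image.1 hr
    obtain ⟨b, hb, rfl⟩ := Finset.mem_image.1 hs
    exact (hp a ha b hb).symm)
  exact ⟨F, fun a ha => hF (a, p a) (Finset.mem_image_of_mem _ ha)⟩

/-! ### Realising sup-norm configurations -/

theorem exists_rat_dist_pi {I : Type*} [Fintype I] (y z : I → ℝ)
    (hy : ∀ i, ∃ q : ℚ, y i = q) (hz : ∀ i, ∃ q : ℚ, z i = q) : ∃ q : ℚ, dist y z = (q : ℝ) := by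
  rcases isEmpty_or_nonempty I with h | h
  · exact ⟨0, by rw [Subsingleton.elim y z]; simp⟩
  obtain ⟨i, -, hi⟩ := Finset.exists_mem_eq_sup (Finset.univ : Finset I) Finset.univ_nonempty
    (fun i => nndist (y i) (z i))
  obtain ⟨q, hq⟩ := hy i
  obtain ⟨r, hr⟩ := hz i
  refine ⟨|q - r|, ?_⟩
  rw [dist_pi_def, hi, coe_nndist, Real.dist_eq, hq, hr]
  push_cast
  rfl

theorem dist_comp_perm {I : Type*} [Fintype I] (σ : Equiv.Perm I) (y z : I → ℝ) :
    dist (y ∘ σ) (z ∘ σ) = dist y z := by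
  have key : ∀ (σ : Equiv.Perm I) (y z : I → ℝ), dist (y ∘ σ) (z ∘ σ) ≤ dist y z := fun σ y z =>
    (dist_pi_le_iff dist_nonneg).2 fun i => dist_le_pi_dist y z (σ i)
  refine le_antisymm (key σ y z) ?_
  have := key σ⁻¹ (y ∘ σ) (z ∘ σ)
  simpa [Function.comp_assoc] using this

/-- A finite set of rational-valued functions, invariant under permuting coordinates, is realised
in the rational Urysohn space together with that permutation, extending a given finite part. -/
theorem IsRationalUrysohn.realize {X : Type*} [MetricSpace X] (hX : IsRationalUrysohn X)
    {I : Type*} [Fintype I] (σ : Equiv.Perm I) (Y : Set (I → ℝ)) (hfin : Y.Finite)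
    (hrat : ∀ y ∈ Y, ∀ i, ∃ q : ℚ, y i = q) (hinv : ∀ y ∈ Y, y ∘ σ ∈ Y)
    (C : Finset X) (j : X → I → ℝ) (hj : ∀ c ∈ C, j c ∈ Y)
    (hiso : ∀ c ∈ C, ∀ c' ∈ C, dist (j c) (j c') = dist c c') :
    ∃ (θ : (I → ℝ) → X) (F : X ≃ᵢ X), (∀ y ∈ Y, ∀ z ∈ Y, dist (θ y) (θ z) = dist y z) ∧
      (∀ c ∈ C, θ (j c) = c) ∧ ∀ y ∈ Y, F (θ y) = θ (y ∘ σ) := by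
  classical
  have := hX.nonempty
  have hjinj : Set.InjOn j C := by
    intro c hc c' hc' h
    have := hiso c hc c' hc'
    rw [h, dist_self] at this
    exact dist_eq_zero.1 this.symm
  have hq : ∀ c ∈ C, Function.invFunOn j C (j c) = c := fun c hc => hjinj.leftInvOn_invFunOn hc
  -- Extending the inverse of `j` from `j '' C` to all of `Y` is what gives `θ (j c) = c`.
  obtain ⟨θ, h1, h2⟩ := hX.exists_extend (C.image j) hfin.toFinset (Function.invFunOn j C)
    (by
      intro a ha b hb
      obtain ⟨c, hc, rfl⟩ := Finset.mem_image.1 ha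
      obtain ⟨c', hc', rfl⟩ := Finset.mem_image.1 hb
      rw [hq c hc, hq c' hc', hiso c hc c' hc'])
    (by
      have hmem : ∀ b, b ∈ C.image j ∨ b ∈ hfin.toFinset → b ∈ Y := by
        rintro b (hb | hb)
        · obtain ⟨c, hc, rfl⟩ := Finset.mem_image.1 hb
          exact hj c hc
        · exact hfin.mem_toFinset.1 hb
      intro a ha b hb
      exact exists_rat_dist_pi a b (hrat a (hmem a (Or.inr ha))) (hrat b (hmem b hb)))
  have hθ : ∀ y ∈ Y, ∀ z ∈ Y, dist (θ y) (θ z) = dist y z := fun y hy z hz =>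
    h2 y (Or.inr (hfin.mem_toFinset.2 hy)) z (Or.inr (hfin.mem_toFinset.2 hz))
  have hθinj : Set.InjOn θ Y := by
    intro y hy z hz h
    have := hθ y hy z hz
    rw [h, dist_self] at this
    exact dist_eq_zero.1 this.symm
  have hr : ∀ y ∈ Y, Function.invFunOn θ Y (θ y) = y := fun y hy => hθinj.leftInvOn_invFunOn hy
  -- Permuting coordinates preserves the sup distance, so its transport by `θ` is a finite partial
  -- isometry.
  obtain ⟨F, hF⟩ := hX.homogeneous (hfin.toFinset.image θ)
    (fun x => θ (Function.invFunOn θ Y x ∘ σ)) (by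
      intro a ha b hb
      obtain ⟨y, hy, rfl⟩ := Finset.mem_image.1 ha
      obtain ⟨z, hz, rfl⟩ := Finset.mem_image.1 hb
      rw [hfin.mem_toFinset] at hy hz
      rw [hr y hy, hr z hz, hθ _ (hinv y hy) _ (hinv z hz), hθ y hy z hz, dist_comp_perm])
  refine ⟨θ, F, hθ, fun c hc => ?_, fun y hy => ?_⟩
  · rw [h1 _ (Finset.mem_image_of_mem j hc), hq c hc]
  · rw [hF _ (Finset.mem_image_of_mem θ (hfin.mem_toFinset.2 hy)), hr y hy]

/-! ### Finite invariant sets and periods -/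

theorem IsometryEquiv.pow_apply_mem {X : Type*} [MetricSpace X] {f : X ≃ᵢ X} {A : Finset X}
    (h : ∀ a ∈ A, f a ∈ A) (n : ℕ) :
    ∀ a ∈ A, (f ^ n) a ∈ A := by
  induction n with
  | zero => exact fun _ ha => ha
  | succ n ih =>
    intro a ha
    rw [pow_succ', IsometryEquiv.mul_apply]
    exact h _ (ih _ ha)

theorem IsometryEquiv.exists_mem_apply_eq {X : Type*} [MetricSpace X] {f : X ≃ᵢ X} {A : Finset X}
    (h : ∀ a ∈ A, f a ∈ A) : ∀ a ∈ A, ∃ b ∈ A, f b = a :=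
  fun _ ha => Finset.surjOn_of_injOn_of_card_le f h f.injective.injOn le_rfl ha

theorem IsometryEquiv.inv_apply_mem {X : Type*} [MetricSpace X] {f : X ≃ᵢ X} {A : Finset X}
    (h : ∀ a ∈ A, f a ∈ A) : ∀ a ∈ A, f⁻¹ a ∈ A := by
  intro a ha
  obtain ⟨b, hb, rfl⟩ := exists_mem_apply_eq h a ha
  change f.symm (f b) ∈ A
  rwa [f.symm_apply_apply]

theorem IsometryEquiv.zpow_apply_mem {X : Type*} [MetricSpace X] {f : X ≃ᵢ X} {A : Finset X}
    (h : ∀ a ∈ A, f a ∈ A) (n : ℤ) : ∀ a ∈ A, (f ^ n) a ∈ A := by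
  obtain ⟨n, rfl | rfl⟩ := n.eq_nat_or_neg
  · rw [zpow_natCast]
    exact pow_apply_mem h n
  · rw [zpow_neg, zpow_natCast]
    exact inv_apply_mem (pow_apply_mem h n)

/-- A common period for finitely many periodic points. -/
theorem IsometryEquiv.exists_common_period {X : Type*} [MetricSpace X] (f : X ≃ᵢ X) (A : Finset X) :
    ∃ P : ℕ, 0 < P ∧ ∀ a ∈ A, (∃ n : ℕ, 0 < n ∧ (f ^ n) a = a) → (f ^ P) a = a := by
  classical
  have hmul : ∀ (a : X) (n m : ℕ), (f ^ n) a = a → (f ^ (n * m)) a = a := by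
    intro a n m h
    induction m with
    | zero => rfl
    | succ m ih => rw [Nat.mul_succ, pow_add, IsometryEquiv.mul_apply, h, ih]
  induction A using Finset.induction_on with
  | empty => exact ⟨1, one_pos, by simp⟩
  | insert a A _ ih =>
    obtain ⟨P, hP, h⟩ := ih
    by_cases ha : ∃ n : ℕ, 0 < n ∧ (f ^ n) a = a
    · obtain ⟨n, hn, hna⟩ := ha
      refine ⟨n * P, Nat.mul_pos hn hP, fun b hb hb' => ?_⟩
      rcases Finset.mem_insert.1 hb with rfl | hb
      · exact hmul _ _ _ hna
      · rw [mul_comm]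
        exact hmul _ _ _ (h b hb hb')
    · refine ⟨P, hP, fun b hb hb' => ?_⟩
      rcases Finset.mem_insert.1 hb with rfl | hb
      · exact absurd hb' ha
      · exact h b hb hb'

theorem IsometryEquiv.exists_period_of_mem {X : Type*} [MetricSpace X] {f : X ≃ᵢ X} {A : Finset X}
    (h : ∀ a ∈ A, f a ∈ A) (a : X) (ha : a ∈ A) : ∃ n : ℕ, 0 < n ∧ (f ^ n) a = a := by
  obtain ⟨i, -, j, -, hij, he⟩ := Set.infinite_univ.exists_ne_map_eq_of_mapsTo
    (f := fun n : ℕ => (f ^ n) a) (t := (A : Set X)) (fun n _ => pow_apply_mem h n a ha)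
    A.finite_toSet
  wlog hlt : i < j generalizing i j
  · exact this j i hij.symm he.symm (by omega)
  refine ⟨j - i, by omega, ?_⟩
  have : (f ^ i) ((f ^ (j - i)) a) = (f ^ i) a := by
    rw [← IsometryEquiv.mul_apply, ← pow_add, Nat.add_sub_cancel' hlt.le]
    exact he.symm
  exact (f ^ i).injective this

theorem Finset.exists_rat_dist_le {X : Type*} [MetricSpace X] (S : Finset X) :
    ∃ K : ℚ, 0 < K ∧ ∀ a ∈ S, ∀ b ∈ S, dist a b ≤ K := by
  obtain ⟨C, hC⟩ := Metric.isBounded_iff.1 S.finite_toSet.isBounded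
  obtain ⟨K, hK⟩ := exists_rat_gt (max C 0)
  refine ⟨K, ?_, fun a ha b hb => (hC ha hb).trans ((le_max_left _ _).trans hK.le)⟩
  exact_mod_cast (le_max_right _ _).trans_lt hK

/-! ### Envelopes -/

/-- The largest function bounded by `K` and by `α a + dist a v` for `a ∈ A`. -/
noncomputable def envelope {X : Type*} [MetricSpace X] (A : Finset X) (K : ℝ) (α : X → ℝ)
    (v : X) : ℝ :=
  A.fold min K fun a => α a + dist a v

section Envelope

variable {X : Type*} [MetricSpace X] {A : Finset X} {K : ℝ} {α : X → ℝ}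

theorem le_envelope {c : ℝ} {v : X} (hK : c ≤ K) (h : ∀ a ∈ A, c ≤ α a + dist a v) :
    c ≤ envelope A K α v :=
  (Finset.le_fold_min c).2 ⟨hK, h⟩

theorem envelope_le_bound (v : X) : envelope A K α v ≤ K :=
  ((Finset.le_fold_min _).1 le_rfl).1

theorem envelope_le {a : X} (ha : a ∈ A) (v : X) : envelope A K α v ≤ α a + dist a v :=
  ((Finset.le_fold_min _).1 le_rfl).2 a ha

theorem envelope_le_add (v w : X) : envelope A K α v ≤ envelope A K α w + dist v w := by
  rw [← sub_le_iff_le_add]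
  refine le_envelope ?_ fun a ha => ?_
  · linarith [envelope_le_bound (A := A) (K := K) (α := α) v, dist_nonneg (x := v) (y := w)]
  · linarith [envelope_le (K := K) (α := α) ha v, dist_triangle_right a v w]

theorem envelope_eq {v : X} (hv : v ∈ A) (h : ∀ a ∈ A, α v ≤ α a + dist a v) :
    envelope A K α v = min K (α v) := by
  refine le_antisymm (le_min (envelope_le_bound v) ?_)
    (le_envelope (min_le_left _ _) fun a ha => (min_le_right _ _).trans (h a ha))
  simpa using envelope_le (K := K) (α := α) hv v

theorem envelope_congr {β : X → ℝ} (h : ∀ a ∈ A, α a = β a) (v : X) :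
    envelope A K α v = envelope A K β v :=
  Finset.fold_congr fun a ha => by rw [h a ha]

/-- Since `f` permutes `A`, moving the point by `f` amounts to moving the prescribed values. This
makes the distance functions built from envelopes equivariant. -/
theorem envelope_apply {f : X ≃ᵢ X} (h : ∀ a ∈ A, f a ∈ A) (v : X) :
    envelope A K α (f v) = envelope A K (fun a => α (f a)) v := by
  refine le_antisymm (le_envelope (envelope_le_bound _) fun a ha => ?_)
    (le_envelope (envelope_le_bound _) fun a ha => ?_)
  · rw [← f.dist_eq a v]
    exact envelope_le (h a ha) _
  · obtain ⟨b, hb, rfl⟩ := IsometryEquiv.exists_mem_apply_eq h a ha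
    rw [f.dist_eq]
    exact envelope_le (α := fun a => α (f a)) hb v

theorem exists_rat_envelope (hX : ∀ x x' : X, ∃ q : ℚ, dist x x' = (q : ℝ))
    (hK : ∃ q : ℚ, K = q) (hα : ∀ a, ∃ q : ℚ, α a = q) (v : X) :
    ∃ q : ℚ, envelope A K α v = q := by
  classical
  unfold envelope
  induction A using Finset.induction_on with
  | empty => simpa using hK
  | insert a A ha ih =>
    rw [Finset.fold_insert ha]
    obtain ⟨p, hp⟩ := ih
    obtain ⟨q, hq⟩ := hα a
    obtain ⟨r, hr⟩ := hX a v
    exact ⟨min (q + r) p, by rw [hp, hq, hr]; push_cast; rfl⟩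

end Envelope

/-- The Kuratowski argument: the Lipschitz bounds give `≤`, and the coordinate at which `y` vanishes
attains the distance. -/
theorem dist_pi_eq_of_lipschitz {X I : Type*} [MetricSpace X] [Fintype I] {y z : I → ℝ} {a b : X}
    (h1 : ∀ i, y i ≤ z i + dist a b) (h2 : ∀ i, z i ≤ y i + dist a b) {i : I} (hy : y i = 0)
    (hz : z i = dist a b) : dist y z = dist a b := by
  refine le_antisymm ((dist_pi_le_iff dist_nonneg).2 fun i => ?_) ?_
  · rw [Real.dist_eq, abs_sub_le_iff]
    constructor <;> linarith [h1 i, h2 i]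
  · have := dist_le_pi_dist y z i
    rwa [hy, hz, Real.dist_eq, zero_sub, abs_neg, abs_of_nonneg dist_nonneg] at this

/-! ### Amalgamation -/

/-- Two isometries with finite invariant sets amalgamate over a common part. -/
theorem IsRationalUrysohn.amalgamate {X : Type*} [MetricSpace X] (hX : IsRationalUrysohn X)
    (f g : X ≃ᵢ X) (A B C : Finset X) (hAB : A ⊆ B) (hAC : A ⊆ C)
    (hA : ∀ a ∈ A, f a ∈ A) (hC : ∀ c ∈ C, f c ∈ C) (hB : ∀ b ∈ B, g b ∈ B)
    (hfg : ∀ a ∈ A, f a = g a) :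
    ∃ k F : X ≃ᵢ X, (∀ a ∈ A, k a = a) ∧ (∀ c ∈ C, F c = f c) ∧ ∀ b ∈ B, F (k b) = k (g b) := by
  classical
  obtain ⟨K, -, hK⟩ := Finset.exists_rat_dist_le (B ∪ C)
  have hgA : ∀ a ∈ A, g a ∈ A := fun a ha => hfg a ha ▸ hA a ha
  -- Across `B` and `C` the prospective distance is the shortest path through `A`. The cap `K`
  -- allows `A` to be empty; as it bounds the distances within `B ∪ C`, it is invisible on `A`,
  -- where `jB` and `jC` agree.
  let jB : X → B ⊕ C → ℝ := fun b =>
    Sum.elim (fun b' => dist b'.1 b) (fun c => envelope A K (dist c.1) b)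
  let jC : X → B ⊕ C → ℝ := fun c =>
    Sum.elim (fun b => envelope A K (dist b.1) c) (fun c' => dist c'.1 c)
  have henv : ∀ x ∈ B ∪ C, ∀ a ∈ A, envelope A K (dist x) a = dist x a := by
    intro x hx a ha
    rw [envelope_eq ha fun b _ => dist_triangle x b a,
      min_eq_right (hK x hx a (Finset.mem_union_left _ (hAB ha)))]
  have hjA : ∀ a ∈ A, jB a = jC a := by
    intro a ha
    funext i
    rcases i with b | c
    · exact (henv b.1 (Finset.mem_union_left _ b.2) a ha).symm
    · exact henv c.1 (Finset.mem_union_right _ c.2) a ha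
  have hBiso : ∀ b ∈ B, ∀ b' ∈ B, dist (jB b) (jB b') = dist b b' := by
    intro b hb b' hb'
    refine dist_pi_eq_of_lipschitz (i := Sum.inl ⟨b, hb⟩) ?_ ?_ (dist_self b) rfl
    · rintro (x | x)
      · exact dist_triangle_right _ _ _
      · exact envelope_le_add _ _
    · rintro (x | x)
      · exact dist_triangle _ _ _
      · rw [dist_comm b b']
        exact envelope_le_add _ _
  have hCiso : ∀ b ∈ C, ∀ b' ∈ C, dist (jC b) (jC b') = dist b b' := by
    intro b hb b' hb'
    refine dist_pi_eq_of_lipschitz (i := Sum.inr ⟨b, hb⟩) ?_ ?_ (dist_self b) rfl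
    · rintro (x | x)
      · exact envelope_le_add _ _
      · exact dist_triangle_right _ _ _
    · rintro (x | x)
      · rw [dist_comm b b']
        exact envelope_le_add _ _
      · exact dist_triangle _ _ _
  let σB : Equiv.Perm B := Equiv.Perm.subtypePermOfFintype g.toEquiv hB
  let σC : Equiv.Perm C := Equiv.Perm.subtypePermOfFintype f.toEquiv hC
  -- Inverses, because `dist x (g b) = dist (g⁻¹ x) b`: precomposition with `σ` then moves points by
  -- `g` and `f`.
  let σ : Equiv.Perm (B ⊕ C) := Equiv.sumCongr σB⁻¹ σC⁻¹
  have hσB : ∀ b : B, g (σB⁻¹ b).1 = b.1 := fun b =>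
    congrArg Subtype.val (σB.apply_symm_apply b)
  have hσC : ∀ c : C, f (σC⁻¹ c).1 = c.1 := fun c =>
    congrArg Subtype.val (σC.apply_symm_apply c)
  have hjB : ∀ b, jB b ∘ σ = jB (g b) := by
    intro b
    funext i
    rcases i with x | x
    · change dist (σB⁻¹ x).1 b = dist x.1 (g b)
      rw [← hσB x, g.dist_eq]
    · change envelope A K (dist (σC⁻¹ x).1) b = envelope A K (dist x.1) (g b)
      rw [envelope_apply hgA]
      refine envelope_congr (fun a ha => ?_) b
      rw [← hfg a ha, ← hσC x, f.dist_eq]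
  have hjC : ∀ c, jC c ∘ σ = jC (f c) := by
    intro c
    funext i
    rcases i with x | x
    · change envelope A K (dist (σB⁻¹ x).1) c = envelope A K (dist x.1) (f c)
      rw [envelope_apply hA]
      refine envelope_congr (fun a ha => ?_) c
      rw [hfg a ha, ← hσB x, g.dist_eq]
    · change dist (σC⁻¹ x).1 c = dist x.1 (f c)
      rw [← hσC x, f.dist_eq]
  obtain ⟨θ, F, hθ, hθC, hF⟩ := hX.realize σ (jB '' B ∪ jC '' C)
    ((B.finite_toSet.image _).union (C.finite_toSet.image _))
    (by
      have he : ∀ x v, ∃ q : ℚ, envelope A K (dist x) v = q := fun x v =>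
        exists_rat_envelope hX.rational ⟨K, rfl⟩ (fun a => hX.rational x a) v
      rintro y (⟨b, -, rfl⟩ | ⟨c, -, rfl⟩) (x | x)
      · exact hX.rational _ _
      · exact he _ _
      · exact he _ _
      · exact hX.rational _ _)
    (by
      rintro y (⟨b, hb, rfl⟩ | ⟨c, hc, rfl⟩)
      · exact Or.inl ⟨g b, hB b hb, (hjB b).symm⟩
      · exact Or.inr ⟨f c, hC c hc, (hjC c).symm⟩)
    C jC (fun c hc => Or.inr ⟨c, hc, rfl⟩) hCiso
  obtain ⟨k, hk⟩ := hX.homogeneous B (fun b => θ (jB b)) (by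
    intro b hb b' hb'
    rw [hθ _ (Or.inl ⟨b, hb, rfl⟩) _ (Or.inl ⟨b', hb', rfl⟩), hBiso b hb b' hb'])
  refine ⟨k, F, fun a ha => ?_, fun c hc => ?_, fun b hb => ?_⟩
  · rw [hk a (hAB ha), hjA a ha, hθC a (hAC ha)]
  · rw [← hθC _ (hC c hc), ← hjC, ← hF _ (Or.inr ⟨c, hc, rfl⟩), hθC c hc]
  · rw [hk b hb, hk _ (hB b hb), ← hjB, hF _ (Or.inl ⟨b, hb, rfl⟩)]

/-! ### Cyclic actions and roots -/

/-- Realisation of a finite set with a cyclic action prescribed by distance-like functions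
`i ↦ Ψ x b i`, to be thought of as the distance from `x` to the `i`-th iterate of `b`. -/
theorem IsRationalUrysohn.realize_cyclic {X : Type*} [MetricSpace X] (hX : IsRationalUrysohn X)
    (B : Finset X) (N : ℕ) (hN : 0 < N) (Ψ : X → X → ℤ → ℝ)
    (hper : ∀ x ∈ B, ∀ b ∈ B, ∀ i, Ψ x b (i + N) = Ψ x b i)
    (hrat : ∀ x ∈ B, ∀ b ∈ B, ∀ i, ∃ q : ℚ, Ψ x b i = q)
    (hlip : ∀ x ∈ B, ∀ b ∈ B, ∀ b' ∈ B, ∀ i, Ψ x b i ≤ Ψ x b' i + dist b b')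
    (hzero : ∀ x ∈ B, ∀ b ∈ B, Ψ x b 0 = dist x b) :
    ∃ (F : X ≃ᵢ X) (T : Finset X), B ⊆ T ∧ (∀ t ∈ T, F t ∈ T) ∧
      ∀ n : ℕ, ∀ b ∈ B, ∀ b' ∈ B, (∀ x ∈ B, ∀ i, Ψ x b (i + n) = Ψ x b' i) → (F ^ n) b = b' := by
  classical
  have : NeZero N := ⟨hN.ne'⟩
  have hmod : ∀ x ∈ B, ∀ b ∈ B, ∀ i j : ℤ, ((i : ℤ) : ZMod N) = (j : ℤ) → Ψ x b i = Ψ x b j := by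
    intro x hx b hb i j h
    have hp : Function.Periodic (Ψ x b) (N : ℤ) := hper x hx b hb
    obtain ⟨k, hk⟩ := (ZMod.intCast_eq_intCast_iff_dvd_sub i j N).1 h
    have := hp.int_mul k i
    rw [← this]
    congr 1
    rw [Int.cast_id]
    linarith
  -- `y b n` encodes the `n`-th iterate of `b`: its coordinate `(x, i)` is the distance from the
  -- `(-i)`-th iterate of `x`. Applying the action is then the shift of `ZMod N`.
  let y : X → ℤ → B × ZMod N → ℝ := fun b n i => Ψ i.1.1 b (i.2.val + n)
  let σ : Equiv.Perm (B × ZMod N) := Equiv.prodCongr (Equiv.refl _) (Equiv.addRight 1)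
  have hyσ : ∀ b ∈ B, ∀ n, y b n ∘ σ = y b (n + 1) := by
    intro b hb n
    funext i
    refine hmod _ i.1.2 b hb _ _ ?_
    change ((((i.2 + 1 : ZMod N).val : ℤ) + n : ℤ) : ZMod N) = _
    push_cast
    rw [ZMod.natCast_zmod_val, ZMod.natCast_zmod_val]
    ring
  let Y : Set (B × ZMod N → ℝ) := ⋃ b ∈ B, Set.range (y b)
  have hYmem : ∀ b ∈ B, ∀ n, y b n ∈ Y := fun b hb n => Set.mem_biUnion hb ⟨n, rfl⟩
  have hY : ∀ z ∈ Y, ∃ b ∈ B, ∃ n, y b n = z := by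
    intro z hz
    simpa [Y] using hz
  have hfin : Y.Finite := by
    refine B.finite_toSet.biUnion fun b hb => ((Finset.range N).finite_toSet.image
      fun n : ℕ => y b n).subset ?_
    rintro _ ⟨n, rfl⟩
    refine ⟨(n : ZMod N).val, by simpa using ZMod.val_lt _, ?_⟩
    funext i
    refine hmod _ i.1.2 b hb _ _ ?_
    push_cast
    rw [ZMod.natCast_zmod_val, ZMod.natCast_zmod_val]
  obtain ⟨θ, F, hθ, hθB, hF⟩ := hX.realize σ Y hfin
    (by
      intro z hz i
      obtain ⟨b, hb, n, rfl⟩ := hY z hz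
      exact hrat _ i.1.2 b hb _)
    (by
      intro z hz
      obtain ⟨b, hb, n, rfl⟩ := hY z hz
      rw [hyσ b hb]
      exact hYmem b hb _)
    B (fun b => y b 0) (fun b hb => hYmem b hb 0)
    (by
      intro b hb b' hb'
      have h0 : ∀ c ∈ B, y c 0 (⟨b, hb⟩, 0) = dist b c := by
        intro c hc
        rw [← hzero b hb c hc]
        exact hmod b hb c hc _ _ (by simp)
      refine dist_pi_eq_of_lipschitz (i := (⟨b, hb⟩, 0)) (fun i => hlip _ i.1.2 b hb b' hb' _)
        (fun i => ?_) (by rw [h0 b hb, dist_self]) (h0 b' hb')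
      rw [dist_comm]
      exact hlip _ i.1.2 b' hb' b hb _)
  refine ⟨F, hfin.toFinset.image θ, fun b hb => ?_, fun t ht => ?_, fun n b hb b' hb' h => ?_⟩
  · rw [← hθB b hb]
    exact Finset.mem_image_of_mem _ (hfin.mem_toFinset.2 (hYmem b hb 0))
  · obtain ⟨z, hz, rfl⟩ := Finset.mem_image.1 ht
    obtain ⟨b, hb, n, rfl⟩ := hY z (hfin.mem_toFinset.1 hz)
    rw [hF _ (hYmem b hb n), hyσ b hb]
    exact Finset.mem_image_of_mem _ (hfin.mem_toFinset.2 (hYmem b hb _))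
  · have key : ∀ n : ℕ, (F ^ n) b = θ (y b n) := by
      intro n
      induction n with
      | zero => exact (hθB b hb).symm
      | succ n ih =>
        rw [pow_succ', IsometryEquiv.mul_apply, ih, hF _ (hYmem b hb n), hyσ b hb]
        push_cast
        rfl
    rw [key, ← hθB b' hb']
    congr 1
    funext i
    change Ψ _ b (_ + _) = Ψ _ b' (_ + 0)
    rw [add_zero]
    exact h _ i.1.2 _

/-- If `G` extends the `n`-th power of `f` restricted to a finite invariant set, then a finite part
of `G` is the `n`-th power of an isometry extending the restriction of `f`. -/
theorem IsRationalUrysohn.exists_root {X : Type*} [MetricSpace X] (hX : IsRationalUrysohn X)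
    (f G : X ≃ᵢ X) (n : ℕ) (hn : 0 < n) (A B : Finset X) (hAB : A ⊆ B)
    (hA : ∀ a ∈ A, f a ∈ A) (hB : ∀ b ∈ B, G b ∈ B) (hfG : ∀ a ∈ A, G a = (f ^ n) a) :
    ∃ (F : X ≃ᵢ X) (T : Finset X), B ⊆ T ∧ (∀ t ∈ T, F t ∈ T) ∧ (∀ a ∈ A, F a = f a) ∧
      ∀ b ∈ B, (F ^ n) b = G b := by
  classical
  obtain ⟨K, -, hK⟩ := Finset.exists_rat_dist_le B
  obtain ⟨P, hP, hPB⟩ := G.exists_common_period B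
  replace hPB : ∀ b ∈ B, (G ^ P) b = b := fun b hb =>
    hPB b hb (IsometryEquiv.exists_period_of_mem hB b hb)
  have hGA : ∀ a ∈ A, G a ∈ A := fun a ha =>
    hfG a ha ▸ IsometryEquiv.pow_apply_mem hA n a ha
  have hn0 : (n : ℤ) ≠ 0 := by exact_mod_cast hn.ne'
  -- The `i`-th iterate of `B` under the root is `B` itself, moved by `G ^ (i / n)`, if `n ∣ i`.
  -- Otherwise it is another copy, glued to `B` only along `A`, where the root acts as `f`.
  let Ψ : X → X → ℤ → ℝ := fun x b i =>
    if (n : ℤ) ∣ i then dist x ((G ^ (i / n)) b)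
    else envelope A K (fun a => dist x ((f ^ i) a)) b
  -- This identity becomes `(F ^ n) b = G b`, and it makes `n * P` a period of `Ψ`.
  have hstep : ∀ x b i, Ψ x b (i + n) = Ψ x (G b) i := by
    intro x b i
    have hd : (n : ℤ) ∣ i + n ↔ (n : ℤ) ∣ i := by simp
    by_cases h : (n : ℤ) ∣ i
    · simp only [Ψ, hd, if_pos h]
      rw [Int.add_ediv_of_dvd_left h, Int.ediv_self hn0, zpow_add_one]
      rfl
    · simp only [Ψ, hd, if_neg h]
      rw [envelope_apply hGA]
      refine envelope_congr (fun a ha => ?_) b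
      rw [hfG a ha, zpow_add, zpow_natCast]
      rfl
  have hpow : ∀ (k : ℤ), ∀ a ∈ A, (G ^ k) a = (f ^ (n * k)) a := by
    have hnat : ∀ (k : ℕ), ∀ a ∈ A, (G ^ k) a = (f ^ (n * k)) a := by
      intro k
      induction k with
      | zero => exact fun a _ => rfl
      | succ k ih =>
        intro a ha
        rw [pow_succ, IsometryEquiv.mul_apply, ih _ (hGA a ha), hfG a ha, Nat.mul_succ, pow_add]
        rfl
    intro k a ha
    obtain ⟨k, rfl | rfl⟩ := k.eq_nat_or_neg
    · rw [zpow_natCast, hnat k a ha]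
      norm_cast
    · rw [zpow_neg, zpow_natCast, mul_neg, zpow_neg]
      have hb := IsometryEquiv.inv_apply_mem (IsometryEquiv.pow_apply_mem hGA k) a ha
      have h2 := hnat k _ hb
      have h3 : (G ^ k) ((G ^ k)⁻¹ a) = a := (G ^ k).apply_symm_apply a
      rw [h3] at h2
      have h4 : (f ^ (n * k))⁻¹ ((f ^ (n * k)) ((G ^ k)⁻¹ a)) = (G ^ k)⁻¹ a :=
        (f ^ (n * k)).symm_apply_apply _
      rw [← h2] at h4
      rw [← h4]
      norm_cast
  have hΨA : ∀ x ∈ B, ∀ a ∈ A, ∀ i, Ψ x a i = dist x ((f ^ i) a) := by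
    intro x hx a ha i
    by_cases h : (n : ℤ) ∣ i
    · simp only [Ψ, if_pos h]
      rw [hpow _ a ha, Int.mul_ediv_cancel' h]
    · simp only [Ψ, if_neg h]
      rw [envelope_eq ha fun b _ => ?_, min_eq_right
        (hK x hx _ (hAB (IsometryEquiv.zpow_apply_mem hA i a ha)))]
      rw [← (f ^ i).dist_eq b a]
      exact dist_triangle _ _ _
  obtain ⟨F, T, hT, hFT, hF⟩ := hX.realize_cyclic B (n * P) (Nat.mul_pos hn hP) Ψ
    (by
      intro x _ b hb i
      have : ∀ k : ℕ, ∀ b i, Ψ x b (i + (n * k : ℕ)) = Ψ x ((G ^ k) b) i := by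
        intro k
        induction k with
        | zero => simp
        | succ k ih =>
          intro b i
          rw [pow_succ', IsometryEquiv.mul_apply, ← hstep, ← ih]
          push_cast
          ring_nf
      rw [this, hPB b hb])
    (by
      intro x _ b _ i
      by_cases h : (n : ℤ) ∣ i
      · simp only [Ψ, if_pos h]
        exact hX.rational _ _
      · simp only [Ψ, if_neg h]
        exact exists_rat_envelope hX.rational ⟨K, rfl⟩ (fun a => hX.rational _ _) b)
    (by
      intro x _ b _ b' _ i
      by_cases h : (n : ℤ) ∣ i
      · simp only [Ψ, if_pos h]
        rw [← (G ^ (i / n)).dist_eq b b']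
        exact dist_triangle_right _ _ _
      · simp only [Ψ, if_neg h]
        exact envelope_le_add _ _)
    (by
      intro x _ b _
      simp [Ψ])
  refine ⟨F, T, hT, hFT, fun a ha => ?_, fun b hb => hF n b hb _ (hB b hb) fun x _ i => hstep x b i⟩
  have := hF 1 a (hAB ha) (f a) (hAB (hA a ha)) (fun x hx i => by
    rw [hΨA x hx a ha, hΨA x hx _ (hA a ha), Nat.cast_one, zpow_add_one]
    rfl)
  rwa [pow_one] at this

/-! ### Finite invariant extensions of a finite part -/

theorem IsometryEquiv.zpow_apply_eq_self {X : Type*} [MetricSpace X] {g : X ≃ᵢ X} {x : X}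
    (h : g x = x) (k : ℤ) : (g ^ k) x = x := by
  have := IsometryEquiv.zpow_apply_mem (A := {x}) (f := g) (by simpa using h) k x (by simp)
  simpa using this

/-- Points of infinite orbits can be numbered along their orbits. -/
theorem IsometryEquiv.exists_orbit_index {X : Type*} [MetricSpace X] (f : X ≃ᵢ X) :
    ∃ e : X → ℤ, ∀ v, (¬ ∃ n : ℕ, 0 < n ∧ (f ^ n) v = v) → ∀ k : ℤ, e ((f ^ k) v) = e v + k := by
  let S : Setoid X :=
    { r := fun v w => ∃ k : ℤ, (f ^ k) v = w
      iseqv :=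
        { refl := fun v => ⟨0, rfl⟩
          symm := by
            rintro v w ⟨k, rfl⟩
            exact ⟨-k, by rw [zpow_neg]; exact (f ^ k).symm_apply_apply v⟩
          trans := by
            rintro u v w ⟨k, rfl⟩ ⟨l, rfl⟩
            exact ⟨l + k, by rw [zpow_add]; rfl⟩ } }
  let r : X → X := fun v => (Quotient.mk S v).out
  have hr : ∀ v, ∃ k : ℤ, (f ^ k) (r v) = v := fun v => Quotient.mk_out (s := S) v
  have hrk : ∀ v (k : ℤ), r ((f ^ k) v) = r v := fun v k =>
    congrArg Quotient.out (Quotient.sound (s := S) (S.symm ⟨k, rfl⟩))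
  choose e he using hr
  refine ⟨e, fun v hv k => ?_⟩
  -- If the numbering failed at `k`, a nonzero power of `f` would fix `v`.
  by_contra hne
  apply hv
  have hsub : ∀ m n : ℤ, (f ^ m) (r v) = (f ^ n) (r v) → (f ^ (m - n)) v = v := by
    intro m n h
    have h' := congrArg (f ^ (e v - n)) h
    rw [← IsometryEquiv.mul_apply, ← IsometryEquiv.mul_apply, ← zpow_add, ← zpow_add,
      sub_add_cancel, he, show e v - n + m = m - n + e v by ring, zpow_add,
      IsometryEquiv.mul_apply, he] at h'
    exact h'
  have h1 : (f ^ e ((f ^ k) v)) (r v) = (f ^ (k + e v)) (r v) := by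
    have := he ((f ^ k) v)
    rw [hrk] at this
    rw [this, zpow_add, IsometryEquiv.mul_apply, he]
  have h2 : (f ^ (e ((f ^ k) v) - (k + e v))) v = v := by
    exact hsub _ _ h1
  refine ⟨(e ((f ^ k) v) - (k + e v)).natAbs, by omega, ?_⟩
  rw [← zpow_natCast]
  rcases Int.natAbs_eq (e ((f ^ k) v) - (k + e v)) with h | h
  · rwa [← h]
  · rw [show (((e ((f ^ k) v) - (k + e v)).natAbs : ℕ) : ℤ) = (e ((f ^ k) v) - (k + e v)) * (-1)
      by omega, zpow_mul]
    exact IsometryEquiv.zpow_apply_eq_self h2 _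

theorem Finset.exists_rat_le_dist {X : Type*} [MetricSpace X] (A : Finset X) :
    ∃ δ : ℚ, 0 < δ ∧ ∀ a ∈ A, ∀ b ∈ A, a ≠ b → (δ : ℝ) ≤ dist a b := by
  have h : ∀ᶠ δ : ℝ in nhdsWithin 0 (Set.Ioi 0), ∀ a ∈ A, ∀ b ∈ A, a ≠ b → δ ≤ dist a b := by
    rw [Filter.eventually_all_finset]
    intro a _
    rw [Filter.eventually_all_finset]
    intro b _
    by_cases hab : a = b
    · exact Filter.Eventually.of_forall fun δ h => absurd hab h
    · filter_upwards [nhdsWithin_le_nhds (Iio_mem_nhds (dist_pos.2 hab))] with δ hδ _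
      exact le_of_lt hδ
  obtain ⟨δ, hδ, hpos⟩ := (h.and self_mem_nhdsWithin).exists
  obtain ⟨q, hq0, hq⟩ := exists_rat_btwn (show (0 : ℝ) < δ from hpos)
  exact ⟨q, by exact_mod_cast hq0, fun a ha b hb hab => hq.le.trans (hδ a ha b hb hab)⟩

theorem exists_rat_iInf_of_finite_range {ι : Type*} [Nonempty ι] {φ : ι → ℝ}
    (hfin : (Set.range φ).Finite) (hrat : ∀ i, ∃ q : ℚ, φ i = q) : ∃ q : ℚ, ⨅ i, φ i = q := by
  obtain ⟨i, hi⟩ := (Set.range_nonempty φ).csInf_mem hfin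
  obtain ⟨q, hq⟩ := hrat i
  exact ⟨q, by rw [← hq, hi]; rfl⟩

/-- Every finite part of an isometry extends to an isometry of a finite set. -/
theorem IsRationalUrysohn.exists_finite_extension {X : Type*} [MetricSpace X]
    (hX : IsRationalUrysohn X) (f : X ≃ᵢ X) (D : Finset X) :
    ∃ (F : X ≃ᵢ X) (T : Finset X), D ⊆ T ∧ (∀ t ∈ T, F t ∈ T) ∧ ∀ a ∈ D, F a = f a := by
  classical
  let A := D ∪ D.image f
  let per : X → Prop := fun v => ∃ n : ℕ, 0 < n ∧ (f ^ n) v = v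
  obtain ⟨e, he⟩ := f.exists_orbit_index
  obtain ⟨K, hK0, hK⟩ := A.exists_rat_dist_le
  obtain ⟨δ, hδ0, hδ⟩ := A.exists_rat_le_dist
  obtain ⟨P, hP, hPA⟩ := f.exists_common_period A
  obtain ⟨L, hL⟩ : ∃ L : ℕ, ∀ a ∈ A, |e a| ≤ L := by
    refine ⟨A.sup fun a => (e a).natAbs, fun a ha => ?_⟩
    rw [Int.abs_eq_natAbs]
    exact_mod_cast Finset.le_sup (f := fun a => (e a).natAbs) ha
  -- The slope of a ramp that varies by at most `δ` over `2 * L` steps; `T` steps suffice for it to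
  -- climb from 0 to `K`.
  let ε : ℚ := δ / (2 * L + 1)
  have hε0 : 0 < ε := by positivity
  have hεδ : ε * (2 * L) ≤ δ := by
    have : ε * (2 * L + 1) = δ := div_mul_cancel₀ _ (by positivity)
    linarith
  obtain ⟨T, hT⟩ := exists_nat_ge (K / ε)
  rw [div_le_iff₀ hε0] at hT
  -- A multiple of `P`, so that `f ^ N` will fix the periodic part pointwise, and so large that
  -- nonzero multiples of `N` carry indices in `[-L, L]` beyond `L + T` in absolute value.
  let N : ℕ := P * (2 * L + T + 1)
  have hN : 0 < N := Nat.mul_pos hP (by omega)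
  have hN' : 2 * L + T + 1 ≤ N := Nat.le_mul_of_pos_left _ hP
  -- the periodic part
  let Z : Finset X := (A.filter per).biUnion fun a => (Finset.range P).image fun k => (f ^ k) a
  have hZ : ∀ z ∈ Z, ∃ a ∈ A, per a ∧ ∃ k < P, (f ^ k) a = z := by
    intro z hz
    obtain ⟨a, ha, h⟩ := Finset.mem_biUnion.1 hz
    obtain ⟨k, hk, rfl⟩ := Finset.mem_image.1 h
    exact ⟨a, (Finset.mem_filter.1 ha).1, (Finset.mem_filter.1 ha).2, k, Finset.mem_range.1 hk, rfl⟩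
  have hZmem : ∀ a ∈ A, per a → ∀ k < P, (f ^ k) a ∈ Z := fun a ha hp k hk =>
    Finset.mem_biUnion.2 ⟨a, Finset.mem_filter.2 ⟨ha, hp⟩,
      Finset.mem_image.2 ⟨k, Finset.mem_range.2 hk, rfl⟩⟩
  have hfZ : ∀ z ∈ Z, f z ∈ Z := by
    intro z hz
    obtain ⟨a, ha, hp, k, hk, rfl⟩ := hZ z hz
    rw [← IsometryEquiv.mul_apply, ← pow_succ']
    rcases Nat.lt_or_ge (k + 1) P with h | h
    · exact hZmem a ha hp _ h
    · rw [show k + 1 = P by omega, hPA a ha hp]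
      exact hZmem a ha hp 0 hP
  have hAZ : ∀ a ∈ A, per a → ∀ k : ℤ, (f ^ k) a ∈ Z := fun a ha hp k =>
    IsometryEquiv.zpow_apply_mem hfZ k a (hZmem a ha hp 0 hP)
  have hPfix : ∀ a, (f ^ P) a = a → ∀ k : ℤ, (f ^ (N * k)) a = a := by
    intro a h k
    rw [show ((N : ℤ) * k) = (P : ℤ) * ((2 * L + T + 1 : ℕ) * k) by simp only [N]; push_cast; ring,
      zpow_mul, zpow_natCast]
    exact IsometryEquiv.zpow_apply_eq_self h _
  have hZfix : ∀ z ∈ Z, ∀ k : ℤ, (f ^ (N * k)) z = z := by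
    intro z hz k
    obtain ⟨a, ha, hp, m, -, rfl⟩ := hZ z hz
    refine hPfix _ ?_ k
    rw [← IsometryEquiv.mul_apply, ← pow_add, add_comm, pow_add, IsometryEquiv.mul_apply,
      hPA a ha hp]
  -- the truncated distance functions
  let ρ : X → X → ℝ := fun x v => min (K : ℝ) (dist x v)
  let u : X → X → ℝ := fun x v => envelope Z K (dist x) v
  let t : ℤ → ℝ := fun i => max 0 (ε * (|i| - L))
  -- Along an infinite orbit, `φ` passes slowly from the capped distance `ρ`, for `|e v| ≤ L`, to
  -- `u`, for `|e v| ≥ L + T`. Unlike `ρ`, the function `u` is invariant under `f ^ N`, which allows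
  -- wrapping the orbit into a cycle.
  let φ : X → X → ℝ := fun x v => max (ρ x v) (min (u x v) (t (e v)))
  have hK0' : (0 : ℝ) ≤ K := by exact_mod_cast hK0.le
  have hε0' : (0 : ℝ) < ε := by exact_mod_cast hε0
  have hρu : ∀ x v, ρ x v ≤ u x v := fun x v =>
    le_envelope (min_le_left _ _) fun a _ => (min_le_right _ _).trans (dist_triangle _ _ _)
  have huZ : ∀ x, ∀ z ∈ Z, u x z = ρ x z := fun x z hz =>
    envelope_eq hz fun a _ => dist_triangle _ _ _
  have huN : ∀ x v (k : ℤ), u x ((f ^ (N * k)) v) = u x v := by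
    intro x v k
    have hz : ∀ z ∈ Z, (f ^ (N * k)) z ∈ Z := fun z hz => by rwa [hZfix z hz]
    refine (envelope_apply hz v).trans (envelope_congr (fun z hz => ?_) v)
    rw [hZfix z hz]
  have hφu : ∀ x v, φ x v ≤ u x v := fun x v => max_le (hρu x v) (min_le_left _ _)
  have hρφ : ∀ x v, ρ x v ≤ φ x v := fun x v => le_max_left _ _
  have hφZ : ∀ x, ∀ z ∈ Z, φ x z = ρ x z := fun x z hz =>
    max_eq_left ((min_le_left _ _).trans (huZ x z hz).le)
  have hφfar : ∀ x v, (L + T : ℤ) ≤ |e v| → φ x v = u x v := by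
    intro x v h
    refine le_antisymm (hφu x v) (le_max_of_le_right (le_min le_rfl ?_))
    refine (envelope_le_bound v).trans (le_max_of_le_right ?_)
    have h' : ((L + T : ℤ) : ℝ) ≤ ((|e v| : ℤ) : ℝ) := by exact_mod_cast h
    have hT' : (K : ℝ) ≤ T * ε := by exact_mod_cast hT
    push_cast at h' ⊢
    nlinarith
  have hφnear : ∀ x v, |e v| ≤ L → φ x v = ρ x v := by
    intro x v h
    have h' : ((|e v| : ℤ) : ℝ) ≤ L := by exact_mod_cast h
    have : t (e v) = 0 := max_eq_left (mul_nonpos_of_nonneg_of_nonpos hε0'.le (by linarith))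
    refine max_eq_left ((min_le_right _ _).trans ?_)
    rw [this]
    exact le_min hK0' dist_nonneg
  have hρlip : ∀ x v w, ρ x v ≤ ρ x w + dist v w := by
    intro x v w
    have h := dist_triangle_right x v w
    rcases min_cases (K : ℝ) (dist x w) with ⟨h1, -⟩ | ⟨h1, -⟩
    · exact (min_le_left _ _).trans (by simp only [ρ, h1]; linarith [dist_nonneg (x := v) (y := w)])
    · exact (min_le_right _ _).trans (by simp only [ρ, h1]; linarith)
  have htlip : ∀ i j : ℤ, |i - j| ≤ 2 * L → t i ≤ t j + δ := by
    intro i j h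
    have h1 : |i| ≤ |j| + 2 * L := by
      have := abs_sub_abs_le_abs_sub i j
      linarith
    have h2 : ((|i| : ℤ) : ℝ) ≤ |j| + 2 * L := by exact_mod_cast h1
    have hδ' : (ε : ℝ) * (2 * L) ≤ δ := by exact_mod_cast hεδ
    have hδ0' : (0 : ℝ) < δ := by exact_mod_cast hδ0
    refine max_le ?_ ?_
    · have := le_max_left (0 : ℝ) (ε * (|j| - L))
      change 0 ≤ max (0 : ℝ) (ε * (|j| - L)) + δ
      linarith
    · have h3 := le_max_right (0 : ℝ) (ε * (|j| - L))
      change _ ≤ max (0 : ℝ) (ε * (|j| - L)) + δ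
      have h4 := mul_le_mul_of_nonneg_left h2 hε0'.le
      push_cast at h2 h3 h4 ⊢
      nlinarith
  have hφlip : ∀ x, ∀ v ∈ A, ∀ w ∈ A, ∀ k : ℤ,
      φ x ((f ^ k) v) ≤ φ x ((f ^ k) w) + dist v w := by
    intro x v hv w hw k
    by_cases hvw : v = w
    · subst hvw
      simp
    rw [← (f ^ k).dist_eq v w]
    by_cases hpv : per v
    · rw [hφZ x _ (hAZ v hv hpv k)]
      exact (hρlip x _ ((f ^ k) w)).trans (by gcongr; exact hρφ _ _)
    by_cases hpw : per w
    · rw [hφZ x _ (hAZ w hw hpw k), ← huZ x _ (hAZ w hw hpw k)]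
      exact (hφu _ _).trans (envelope_le_add _ _)
    -- The indices of `v` and `w` differ by at most `2 * L`, so the ramp changes by at most `δ ≤
    -- dist v w`.
    have htt : t (e ((f ^ k) v)) ≤ t (e ((f ^ k) w)) + dist ((f ^ k) v) ((f ^ k) w) := by
      rw [he v hpv, he w hpw, (f ^ k).dist_eq]
      refine (htlip (e v + k) (e w + k) ?_).trans (by gcongr; exact hδ v hv w hw hvw)
      have h1 := abs_le.1 (hL v hv)
      have h2 := abs_le.1 (hL w hw)
      rw [abs_le]
      constructor <;> linarith
    have hmin : min (u x ((f ^ k) v)) (t (e ((f ^ k) v))) ≤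
        min (u x ((f ^ k) w)) (t (e ((f ^ k) w))) + dist ((f ^ k) v) ((f ^ k) w) := by
      rw [← min_add_add_right]
      exact min_le_min (envelope_le_add _ _) htt
    rw [← max_add_add_right]
    exact max_le_max (hρlip _ _ _) hmin
  -- periodisation
  let Ψ : X → X → ℤ → ℝ := fun x v i => ⨅ k : ℤ, φ x ((f ^ (N * k + i)) v)
  have hbdd : ∀ x v i, BddBelow (Set.range fun k : ℤ => φ x ((f ^ (N * k + i)) v)) := by
    intro x v i
    refine ⟨0, ?_⟩
    rintro _ ⟨k, rfl⟩
    exact (le_min hK0' dist_nonneg).trans (hρφ _ _)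
  obtain ⟨F, S, hS, hFS, hF⟩ := hX.realize_cyclic A N hN Ψ
    (by
      intro x _ v _ i
      refine (Equiv.addRight (1 : ℤ)).iInf_congr fun k => ?_
      change φ x ((f ^ (N * (k + 1) + i)) v) = _
      congr 3
      ring)
    (by
      intro x _ v hv i
      -- On an infinite orbit all but finitely many `k` give the common value `u`, so the infimum is
      -- attained and rational.
      refine exists_rat_iInf_of_finite_range ?_ fun k => ?_
      · by_cases hpv : per v
        · refine (Set.finite_singleton (φ x ((f ^ i) v))).subset ?_
          rintro _ ⟨k, rfl⟩
          change φ x ((f ^ (N * k + i)) v) = φ x ((f ^ i) v)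
          rw [zpow_add, IsometryEquiv.mul_apply, hZfix _ (hAZ v hv hpv i)]
        · refine (((Finset.Icc (-(L + T + |e v + i|)) (L + T + |e v + i|)).finite_toSet.image
            fun k : ℤ => φ x ((f ^ (N * k + i)) v)).union
              (Set.finite_singleton (u x ((f ^ i) v)))).subset ?_
          rintro _ ⟨k, rfl⟩
          by_cases hk : |k| ≤ L + T + |e v + i|
          · exact Or.inl ⟨k, by simpa [abs_le] using hk, rfl⟩
          · right
            change φ x ((f ^ (N * k + i)) v) = u x ((f ^ i) v)
            rw [hφfar, zpow_add, IsometryEquiv.mul_apply, huN]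
            rw [he v hpv]
            have h1 : |(N : ℤ) * k| = N * |k| := by rw [abs_mul, Nat.abs_cast]
            have h2 : |k| ≤ (N : ℤ) * |k| :=
              le_mul_of_one_le_left (abs_nonneg k) (by exact_mod_cast hN)
            have h3 := abs_sub_abs_le_abs_sub ((N : ℤ) * k) (-(e v + i))
            rw [abs_neg, show (N : ℤ) * k - -(e v + i) = e v + (N * k + i) by ring] at h3
            linarith
      · obtain ⟨q, hq⟩ := hX.rational x ((f ^ (N * k + i)) v)
        obtain ⟨r, hr⟩ := exists_rat_envelope (A := Z) hX.rational ⟨K, rfl⟩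
          (hX.rational x) ((f ^ (N * k + i)) v)
        refine ⟨max (min K q) (min r (max 0 (ε * (|e ((f ^ (N * k + i)) v)| - L)))), ?_⟩
        simp only [φ, ρ, u, t, hq, hr]
        push_cast
        rfl)
    (by
      intro x _ v hv w hw i
      rw [← sub_le_iff_le_add]
      refine le_ciInf fun k => ?_
      rw [sub_le_iff_le_add]
      exact (ciInf_le (hbdd x v i) k).trans (hφlip x v hv w hw _))
    (by
      intro x hx v hv
      have hρ : ρ x v = dist x v := min_eq_right (hK x hx v hv)
      rw [← hρ]
      -- The term `k = 0` is the true distance. For `k ≠ 0` on an infinite orbit the index lies in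
      -- the far range, and the term is `u ≥ ρ`: wrapping creates no shortcut.
      refine le_antisymm ((ciInf_le (hbdd x v 0) 0).trans ?_) (le_ciInf fun k => ?_)
      · rw [mul_zero, add_zero]
        exact (hφnear x v (hL v hv)).le
      · rw [add_zero]
        by_cases hpv : per v
        · rw [hPfix v (hPA v hv hpv)]
          exact hρφ x v
        rcases eq_or_ne k 0 with rfl | hk
        · rw [mul_zero]
          exact hρφ x v
        rw [hφfar, huN]
        · exact hρu x v
        · rw [he v hpv]
          have h1 : |(N : ℤ) * k| = N * |k| := by rw [abs_mul, Nat.abs_cast]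
          have h2 : (N : ℤ) ≤ N * |k| :=
            le_mul_of_one_le_right (by positivity) (Int.one_le_abs hk)
          have h3 := abs_sub_abs_le_abs_sub ((N : ℤ) * k) (-(e v))
          rw [abs_neg, show (N : ℤ) * k - -(e v) = e v + N * k by ring] at h3
          have h4 := hL v hv
          have h5 : (2 * L + T + 1 : ℤ) ≤ N := by exact_mod_cast hN'
          linarith)
  refine ⟨F, S, Finset.subset_union_left.trans hS, hFS, fun a ha => ?_⟩
  have := hF 1 a (Finset.mem_union_left _ ha) (f a)
    (Finset.mem_union_right _ (Finset.mem_image_of_mem f ha)) (fun x _ i => by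
      refine iInf_congr fun k => ?_
      rw [Nat.cast_one, ← add_assoc, zpow_add_one]
      rfl)
  rwa [pow_one] at this

/-! ### Rich isometries and their powers -/

/-- An isometry with finite orbits which realises every finite extension of each of its finite
invariant parts. -/
structure IsRichIsometry {X : Type*} [MetricSpace X] (f : X ≃ᵢ X) : Prop where
  finite_orbit : ∀ x, ∃ T : Finset X, x ∈ T ∧ ∀ t ∈ T, f t ∈ T
  extension : ∀ (A B : Finset X) (g : X ≃ᵢ X), A ⊆ B → (∀ a ∈ A, g a ∈ A) → (∀ b ∈ B, g b ∈ B) →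
    (∀ a ∈ A, f a = g a) → ∃ k : X ≃ᵢ X, (∀ a ∈ A, k a = a) ∧ ∀ b ∈ B, f (k b) = k (g b)

theorem IsRichIsometry.exists_invariant {X : Type*} [MetricSpace X] {f : X ≃ᵢ X}
    (hf : IsRichIsometry f) (A : Finset X) : ∃ T : Finset X, A ⊆ T ∧ ∀ t ∈ T, f t ∈ T := by
  classical
  choose T hT hfT using hf.finite_orbit
  refine ⟨A.biUnion T, fun a ha => Finset.mem_biUnion.2 ⟨a, ha, hT a⟩, fun t ht => ?_⟩
  obtain ⟨a, ha, hta⟩ := Finset.mem_biUnion.1 ht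
  exact Finset.mem_biUnion.2 ⟨a, ha, hfT a t hta⟩

theorem IsRichIsometry.inv {X : Type*} [MetricSpace X] {f : X ≃ᵢ X} (hf : IsRichIsometry f) :
    IsRichIsometry f⁻¹ where
  finite_orbit x := by
    obtain ⟨T, hx, hT⟩ := hf.finite_orbit x
    exact ⟨T, hx, IsometryEquiv.inv_apply_mem hT⟩
  extension A B g hAB hA hB hfg := by
    have hg : ∀ x, g⁻¹ (g x) = x := g.symm_apply_apply
    have hff : ∀ x, f (f⁻¹ x) = x := f.apply_symm_apply
    have hff' : ∀ x, f⁻¹ (f x) = x := f.symm_apply_apply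
    obtain ⟨k, hk, h⟩ := hf.extension A B g⁻¹ hAB (IsometryEquiv.inv_apply_mem hA)
      (IsometryEquiv.inv_apply_mem hB) (fun a ha => by
        obtain ⟨b, hb, rfl⟩ := IsometryEquiv.exists_mem_apply_eq hA a ha
        rw [hg, ← hfg b hb, hff])
    refine ⟨k, hk, fun b hb => ?_⟩
    rw [← hff' (k (g b)), h _ (hB b hb), hg]

/-- The set `A` is invariant under `f ^ n` but perhaps not under `f`, so it is first enlarged to an
`f`-invariant `C`. Amalgamating `g` with `f ^ n` over `A` gives a `G` on `C ∪ k(B)`; an `n`-th root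
of `G` extending `f` on `C` is then realised by the richness of `f`. -/
theorem IsRichIsometry.pow {X : Type*} [MetricSpace X] (hX : IsRationalUrysohn X) {f : X ≃ᵢ X}
    (hf : IsRichIsometry f) {n : ℕ} (hn : 0 < n) : IsRichIsometry (f ^ n) where
  finite_orbit x := by
    obtain ⟨T, hx, hT⟩ := hf.finite_orbit x
    exact ⟨T, hx, IsometryEquiv.pow_apply_mem hT n⟩
  extension A B g hAB hA hB hfg := by
    classical
    obtain ⟨C, hAC, hC⟩ := hf.exists_invariant A
    have hCn := IsometryEquiv.pow_apply_mem hC n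
    obtain ⟨k, G, hk, hG, hGk⟩ := hX.amalgamate (f ^ n) g A B C hAB hAC
      (fun a ha => hfg a ha ▸ hA a ha) hCn hB hfg
    obtain ⟨F, T, hT, hFT, hF, hFn⟩ := hX.exists_root f G n hn C (C ∪ B.image k)
      Finset.subset_union_left hC (by
        intro b hb
        rcases Finset.mem_union.1 hb with hb | hb
        · rw [hG b hb]
          exact Finset.mem_union_left _ (hCn b hb)
        · obtain ⟨b', hb', rfl⟩ := Finset.mem_image.1 hb
          rw [hGk b' hb']
          exact Finset.mem_union_right _ (Finset.mem_image_of_mem k (hB b' hb'))) hG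
    obtain ⟨l, hl, hfl⟩ := hf.extension C T F (Finset.subset_union_left.trans hT)
      (fun a ha => hF a ha ▸ hC a ha) hFT (fun a ha => (hF a ha).symm)
    have hpow : ∀ m : ℕ, ∀ t ∈ T, (f ^ m) (l t) = l ((F ^ m) t) := by
      intro m
      induction m with
      | zero => exact fun _ _ => rfl
      | succ m ih =>
        intro t ht
        rw [pow_succ', pow_succ', IsometryEquiv.mul_apply, IsometryEquiv.mul_apply, ih t ht,
          hfl _ (IsometryEquiv.pow_apply_mem hFT m t ht)]
    refine ⟨l * k, fun a ha => ?_, fun b hb => ?_⟩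
    · rw [IsometryEquiv.mul_apply, hk a ha, hl a (hAC ha)]
    · have hkb := Finset.mem_union_right C (Finset.mem_image_of_mem k hb)
      rw [IsometryEquiv.mul_apply, IsometryEquiv.mul_apply, hpow n _ (hT hkb), hFn _ hkb, hGk b hb]

theorem IsRichIsometry.zpow {X : Type*} [MetricSpace X] (hX : IsRationalUrysohn X) {f : X ≃ᵢ X}
    (hf : IsRichIsometry f) {n : ℤ} (hn : n ≠ 0) : IsRichIsometry (f ^ n) := by
  obtain ⟨m, rfl | rfl⟩ := n.eq_nat_or_neg
  · rw [zpow_natCast]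
    exact hf.pow hX (by omega)
  · rw [zpow_neg, zpow_natCast]
    exact (hf.pow hX (by omega)).inv

/-! ### Conjugacy of rich isometries -/

/-- Finite partial isometries intertwining `f₁` and `f₂`. -/
def IsIntertwining {X : Type*} [MetricSpace X] (f₁ f₂ : X ≃ᵢ X) (R : Finset (X × X)) : Prop :=
  IsIsometricRel (R : Set (X × X)) ∧ ∀ r ∈ R, (f₁ r.1, f₂ r.2) ∈ R

theorem IsIntertwining.swap {X : Type*} [MetricSpace X] [DecidableEq X] {f₁ f₂ : X ≃ᵢ X}
    {R : Finset (X × X)} (hR : IsIntertwining f₁ f₂ R) :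
    IsIntertwining f₂ f₁ (R.image Prod.swap) := by
  constructor
  · intro r hr s hs
    obtain ⟨r, hr', rfl⟩ := Finset.mem_image.1 hr
    obtain ⟨s, hs', rfl⟩ := Finset.mem_image.1 hs
    exact (hR.1 r hr' s hs').symm
  · intro r hr
    obtain ⟨r, hr', rfl⟩ := Finset.mem_image.1 hr
    exact Finset.mem_image_of_mem Prod.swap (hR.2 r hr')

/-- Extend `R` to an isometry `h` and transport `f₁` by it. The conjugate agrees with `f₂` on the
range of `R`, so the richness of `f₂` corrects `h` to an intertwining `k ∘ h` on a finite
`f₁`-invariant set containing `x`. -/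
theorem IsIntertwining.forth {X : Type*} [MetricSpace X] (hX : IsRationalUrysohn X)
    {f₁ f₂ : X ≃ᵢ X} (h₁ : IsRichIsometry f₁) (h₂ : IsRichIsometry f₂) {R : Finset (X × X)}
    (hR : IsIntertwining f₁ f₂ R) (x : X) :
    ∃ R', IsIntertwining f₁ f₂ R' ∧ R ⊆ R' ∧ ∃ y, (x, y) ∈ R' := by
  classical
  obtain ⟨h, hh⟩ := hX.homogeneous_rel R hR.1
  obtain ⟨B, hB, hfB⟩ := h₁.exists_invariant (insert x (R.image Prod.fst))
  have hRB : ∀ r ∈ R, r.1 ∈ B := fun r hr =>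
    hB (Finset.mem_insert_of_mem (Finset.mem_image_of_mem _ hr))
  have hg : ∀ y, (h * f₁ * h⁻¹) (h y) = h (f₁ y) := fun y =>
    congrArg (fun z => h (f₁ z)) (h.symm_apply_apply y)
  obtain ⟨k, hk, hfk⟩ := h₂.extension (R.image Prod.snd) (B.image h) (h * f₁ * h⁻¹)
    (by
      intro y hy
      obtain ⟨r, hr, rfl⟩ := Finset.mem_image.1 hy
      rw [← hh r hr]
      exact Finset.mem_image_of_mem h (hRB r hr))
    (by
      intro y hy
      obtain ⟨r, hr, rfl⟩ := Finset.mem_image.1 hy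
      have := hR.2 r hr
      rw [← hh r hr, hg, hh _ this]
      exact Finset.mem_image_of_mem Prod.snd this)
    (by
      intro y hy
      obtain ⟨b, hb, rfl⟩ := Finset.mem_image.1 hy
      rw [hg]
      exact Finset.mem_image_of_mem h (hfB b hb))
    (by
      intro y hy
      obtain ⟨r, hr, rfl⟩ := Finset.mem_image.1 hy
      conv_rhs => rw [← hh r hr]
      rw [hg, hh _ (hR.2 r hr)])
  refine ⟨B.image fun b => (b, k (h b)), ⟨?_, ?_⟩, ?_, k (h x), ?_⟩
  · intro r hr s hs
    obtain ⟨b, -, rfl⟩ := Finset.mem_image.1 hr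
    obtain ⟨c, -, rfl⟩ := Finset.mem_image.1 hs
    change dist b c = dist (k (h b)) (k (h c))
    rw [k.dist_eq, h.dist_eq]
  · intro r hr
    obtain ⟨b, hb, rfl⟩ := Finset.mem_image.1 hr
    change (f₁ b, f₂ (k (h b))) ∈ _
    rw [hfk _ (Finset.mem_image_of_mem h hb), hg]
    exact Finset.mem_image_of_mem (fun b => (b, k (h b))) (hfB b hb)
  · intro r hr
    refine Finset.mem_image.2 ⟨r.1, hRB r hr, ?_⟩
    rw [hh r hr, hk _ (Finset.mem_image_of_mem Prod.snd hr)]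
  · exact Finset.mem_image_of_mem (fun b => (b, k (h b))) (hB (Finset.mem_insert_self _ _))

theorem IsRichIsometry.isConj {X : Type*} [MetricSpace X] (hX : IsRationalUrysohn X)
    {f₁ f₂ : X ≃ᵢ X} (h₁ : IsRichIsometry f₁) (h₂ : IsRichIsometry f₂) : IsConj f₁ f₂ := by
  classical
  have := hX.countable
  obtain ⟨F, -, hF⟩ := exists_isometryEquiv_of_backAndForth (IsIntertwining f₁ f₂)
    (fun _ h => h.1) (fun R hR x => hR.forth hX h₁ h₂ x)
    (by
      intro R hR y
      obtain ⟨R', hR', hsub, x, hx⟩ := hR.swap.forth hX h₂ h₁ y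
      refine ⟨R'.image Prod.swap, hR'.swap, fun r hr => ?_, x,
        Finset.mem_image.2 ⟨(y, x), hx, rfl⟩⟩
      exact Finset.mem_image.2 ⟨r.swap, hsub (Finset.mem_image_of_mem _ hr), Prod.swap_swap r⟩)
    ∅ ⟨by simp [IsIsometricRel], by simp⟩
  refine isConj_iff.2 ⟨F, ?_⟩
  rw [mul_inv_eq_iff_eq_mul]
  ext x
  obtain ⟨R, hR, hx, hgr⟩ := hF x
  exact hgr _ (hR.2 _ hx)

/-! ### Baire category in the permutation topology -/

section Topology

attribute [local instance] permutationTopology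

theorem isTopologicalBasis_permutationTopology (X : Type*) [MetricSpace X] :
    TopologicalSpace.IsTopologicalBasis
      {U | ∃ (f : X ≃ᵢ X) (A : Finset X), U = {g : X ≃ᵢ X | ∀ x ∈ A, g x = f x}} where
  exists_subset_inter := by
    classical
    rintro _ ⟨f, A, rfl⟩ _ ⟨f', A', rfl⟩ h ⟨hA, hA'⟩
    refine ⟨_, ⟨h, A ∪ A', rfl⟩, fun x _ => rfl, fun g hg => ⟨fun x hx => ?_, fun x hx => ?_⟩⟩
    · rw [hg x (Finset.mem_union_left _ hx), hA x hx]
    · rw [hg x (Finset.mem_union_right _ hx), hA' x hx]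
  sUnion_eq := Set.eq_univ_of_forall fun f => ⟨_, ⟨f, ∅, rfl⟩, fun _ _ => rfl⟩
  eq_generateFrom := rfl

theorem isOpen_permutationTopology_iff {X : Type*} [MetricSpace X] {U : Set (X ≃ᵢ X)} :
    IsOpen U ↔ ∀ f ∈ U, ∃ A : Finset X, ∀ g : X ≃ᵢ X, (∀ x ∈ A, g x = f x) → g ∈ U := by
  rw [(isTopologicalBasis_permutationTopology X).isOpen_iff]
  refine forall₂_congr fun f _ => ⟨?_, ?_⟩
  · rintro ⟨_, ⟨f', A, rfl⟩, hf, hsub⟩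
    exact ⟨A, fun g hg => hsub fun x hx => (hg x hx).trans (hf x hx)⟩
  · rintro ⟨A, hA⟩
    exact ⟨_, ⟨f, A, rfl⟩, fun _ _ => rfl, hA⟩

theorem dense_permutationTopology {X : Type*} [MetricSpace X] {U : Set (X ≃ᵢ X)}
    (h : ∀ (f : X ≃ᵢ X) (A : Finset X), ∃ g ∈ U, ∀ x ∈ A, g x = f x) : Dense U := by
  rw [(isTopologicalBasis_permutationTopology X).dense_iff]
  rintro _ ⟨f, A, rfl⟩ -
  obtain ⟨g, hgU, hg⟩ := h f A
  exact ⟨g, hg, hgU⟩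

-- The pair `(f, f⁻¹)` embeds the group as a closed subset of a Polish space. Recording the inverse
-- matters: a pointwise limit of surjective isometries need not be surjective.
open Topology in
theorem baireSpace_permutationTopology (X : Type*) [MetricSpace X] [Countable X] :
    BaireSpace (X ≃ᵢ X) := by
  classical
  obtain ⟨c, hc⟩ := exists_injective_nat X
  let Φ : (X ≃ᵢ X) → (X → ℕ) × (X → ℕ) := fun f => (fun x => c (f x), fun x => c (f⁻¹ x))
  have hinv : ∀ (g : X ≃ᵢ X) (x y : X), g x = y → g⁻¹ y = x := fun g x y h =>
    (g.symm_apply_eq).2 h.symm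
  have happ : ∀ (g : X ≃ᵢ X) (x y : X), g⁻¹ y = x → g x = y := fun g x y h =>
    ((g.symm_apply_eq).1 h).symm
  have hcont : Continuous Φ := by
    refine Continuous.prodMk (continuous_pi fun x => ?_) (continuous_pi fun x => ?_)
    · refine continuous_discrete_rng.2 fun n => isOpen_permutationTopology_iff.2 fun f hf => ?_
      refine ⟨{x}, fun g hg => ?_⟩
      change c (g x) = n
      rw [hg x (Finset.mem_singleton_self x)]
      exact hf
    · refine continuous_discrete_rng.2 fun n => isOpen_permutationTopology_iff.2 fun f hf => ?_
      refine ⟨{f⁻¹ x}, fun g hg => ?_⟩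
      change c (g⁻¹ x) = n
      have := hg _ (Finset.mem_singleton_self _)
      rw [hinv g _ _ (this.trans (happ f _ x rfl))]
      exact hf
  have hcyl : ∀ (p : (X → ℕ) × (X → ℕ)) (S : Finset X),
      IsOpen {q : (X → ℕ) × (X → ℕ) | ∀ x ∈ S, q.1 x = p.1 x ∧ q.2 x = p.2 x} := by
    intro p S
    simp only [Set.ofPred_forall]
    refine isOpen_biInter_finset fun x _ => ?_
    have := (isOpen_discrete ({(p.1 x, p.2 x)} : Set (ℕ × ℕ))).preimage
      (f := fun q : (X → ℕ) × (X → ℕ) => (q.1 x, q.2 x)) (by fun_prop)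
    convert this using 1
    ext q
    simp [Prod.ext_iff]
  have hind : IsInducing Φ := by
    refine isInducing_iff_nhds.2 fun f => le_antisymm (hcont.tendsto f).le_comap fun U hU => ?_
    obtain ⟨V, hVU, hV, hfV⟩ := mem_nhds_iff.1 hU
    obtain ⟨A, hA⟩ := isOpen_permutationTopology_iff.1 hV f hfV
    refine ⟨_, (hcyl (Φ f) A).mem_nhds fun _ _ => ⟨rfl, rfl⟩, fun g hg => hVU (hA g fun x hx => ?_)⟩
    exact hc (hg x hx).1
  have hinj : Function.Injective Φ := fun f g h => by
    ext x
    exact hc (congrFun (congrArg Prod.fst h) x)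
  have hclosed : IsClosed (Set.range Φ) := by
    refine isClosed_of_closure_subset fun p hp => ?_
    have happrox : ∀ S : Finset X, ∃ g : X ≃ᵢ X, ∀ x ∈ S, c (g x) = p.1 x ∧ c (g⁻¹ x) = p.2 x := by
      intro S
      obtain ⟨_, hq, g, rfl⟩ := mem_closure_iff.1 hp _ (hcyl p S) fun _ _ => ⟨rfl, rfl⟩
      exact ⟨g, hq⟩
    have hFG : ∀ x, ∃ y z, c y = p.1 x ∧ c z = p.2 x := fun x => by
      obtain ⟨g, hg⟩ := happrox {x}
      exact ⟨_, _, hg x (Finset.mem_singleton_self x)⟩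
    choose F G hF hG using hFG
    have happrox' : ∀ S : Finset X, ∃ g : X ≃ᵢ X, ∀ x ∈ S, g x = F x ∧ g⁻¹ x = G x := by
      intro S
      obtain ⟨g, hg⟩ := happrox S
      exact ⟨g, fun x hx => ⟨hc ((hg x hx).1.trans (hF x).symm), hc ((hg x hx).2.trans (hG x).symm)⟩⟩
    have hFG : ∀ y, F (G y) = y := by
      intro y
      obtain ⟨g, hg⟩ := happrox' {y, G y}
      rw [← (hg (G y) (by simp)).1]
      exact happ g _ _ (hg y (by simp)).2
    let E : X ≃ᵢ X := IsometryEquiv.mk' F G hFG (Isometry.of_dist_eq fun x y => by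
      obtain ⟨g, hg⟩ := happrox' {x, y}
      rw [← (hg x (by simp)).1, ← (hg y (by simp)).1, g.dist_eq])
    refine ⟨E, Prod.ext (funext hF) (funext fun x => ?_)⟩
    change c (E⁻¹ x) = p.2 x
    rw [hinv E (G x) x (hFG x), hG]
  have := IsClosedEmbedding.IsCompletelyMetrizableSpace ⟨⟨hind, hinj⟩, hclosed⟩
  infer_instance

theorem IsRationalUrysohn.residual_finite_orbit {X : Type*} [MetricSpace X]
    (hX : IsRationalUrysohn X) (x : X) :
    ∀ᶠ f in residual (X ≃ᵢ X), ∃ T : Finset X, x ∈ T ∧ ∀ t ∈ T, f t ∈ T := by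
  classical
  refine residual_of_dense_open (isOpen_permutationTopology_iff.2 ?_)
    (dense_permutationTopology fun f A => ?_)
  · rintro f ⟨T, hx, hT⟩
    exact ⟨T, fun g hg => ⟨T, hx, fun t ht => by rw [hg t ht]; exact hT t ht⟩⟩
  · obtain ⟨F, T, hT, hFT, hF⟩ := hX.exists_finite_extension f (insert x A)
    exact ⟨F, ⟨T, hT (Finset.mem_insert_self _ _), hFT⟩, fun a ha =>
      hF a (Finset.mem_insert_of_mem ha)⟩

/-- Openness: a copy of `g` is witnessed by the values of `f` on `k(B)`, and disagreement with `g`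
by those on `A`. Density: make the prescribed part of `f` finite and invariant, then amalgamate it
with `g` over `A`. -/
theorem IsRationalUrysohn.residual_extension {X : Type*} [MetricSpace X]
    (hX : IsRationalUrysohn X) (A B : Finset X) (g : X ≃ᵢ X) (hAB : A ⊆ B)
    (hA : ∀ a ∈ A, g a ∈ A) (hB : ∀ b ∈ B, g b ∈ B) :
    ∀ᶠ f in residual (X ≃ᵢ X), (∀ a ∈ A, f a = g a) →
      ∃ k : X ≃ᵢ X, (∀ a ∈ A, k a = a) ∧ ∀ b ∈ B, f (k b) = k (g b) := by
  classical
  refine residual_of_dense_open (isOpen_permutationTopology_iff.2 fun f hf => ?_)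
    (dense_permutationTopology fun f C => ?_)
  · by_cases hfg : ∀ a ∈ A, f a = g a
    · obtain ⟨k, hk, h⟩ := hf hfg
      refine ⟨B.image k, fun f' hf' _ => ⟨k, hk, fun b hb => ?_⟩⟩
      rw [hf' _ (Finset.mem_image_of_mem k hb), h b hb]
    · exact ⟨A, fun f' hf' hf'g => absurd (fun a ha => (hf' a ha).symm.trans (hf'g a ha)) hfg⟩
  · by_cases hfg : ∀ a ∈ A, f a = g a
    · obtain ⟨F, T, hT, hFT, hF⟩ := hX.exists_finite_extension f (C ∪ A)
      have hFA : ∀ a ∈ A, F a = g a := fun a ha =>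
        (hF a (Finset.mem_union_right _ ha)).trans (hfg a ha)
      obtain ⟨k, F', hk, hF', h⟩ := hX.amalgamate F g A B T hAB
        (Finset.subset_union_right.trans hT) (fun a ha => by rw [hFA a ha]; exact hA a ha)
        hFT hB hFA
      refine ⟨F', fun _ => ⟨k, hk, h⟩, fun x hx => ?_⟩
      have hx' := Finset.mem_union_left A hx
      rw [hF' x (hT hx'), hF x hx']
    · exact ⟨f, fun h => absurd h hfg, fun _ _ => rfl⟩

theorem IsRationalUrysohn.residual_isRichIsometry {X : Type*} [MetricSpace X]
    (hX : IsRationalUrysohn X) : ∀ᶠ f in residual (X ≃ᵢ X), IsRichIsometry f := by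
  classical
  have := hX.countable
  -- Only the restriction of `g` to `B` matters. Indexing by its finite graph leaves countably many
  -- conditions, although the isometries `g` may be uncountably many.
  have h2 : ∀ᶠ f in residual (X ≃ᵢ X), ∀ (i : Finset X × Finset X × Finset (X × X)) (g : X ≃ᵢ X),
      i.1 ⊆ i.2.1 → (∀ a ∈ i.1, g a ∈ i.1) → (∀ b ∈ i.2.1, g b ∈ i.2.1) →
      i.2.1.image (fun b => (b, g b)) = i.2.2 → (∀ a ∈ i.1, f a = g a) →
      ∃ k : X ≃ᵢ X, (∀ a ∈ i.1, k a = a) ∧ ∀ b ∈ i.2.1, f (k b) = k (g b) := by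
    rw [eventually_countable_forall]
    rintro ⟨A, B, R⟩
    by_cases h : ∃ g : X ≃ᵢ X, A ⊆ B ∧ (∀ a ∈ A, g a ∈ A) ∧ (∀ b ∈ B, g b ∈ B) ∧
        B.image (fun b => (b, g b)) = R
    · obtain ⟨g, hAB, hA, hB, rfl⟩ := h
      filter_upwards [hX.residual_extension A B g hAB hA hB] with f hf g' _ _ _ hg' hfg'
      have hgg : ∀ b ∈ B, g' b = g b := by
        intro b hb
        have := Finset.mem_image_of_mem (fun b => (b, g' b)) hb
        rw [hg'] at this
        obtain ⟨b', -, h⟩ := Finset.mem_image.1 this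
        obtain ⟨rfl, h⟩ := Prod.ext_iff.1 h
        exact h.symm
      obtain ⟨k, hk, h⟩ := hf fun a ha => (hfg' a ha).trans (hgg a (hAB ha))
      exact ⟨k, hk, fun b hb => by rw [h b hb, hgg b hb]⟩
    · exact Filter.Eventually.of_forall fun f g h1 h2 h3 h4 => absurd ⟨g, h1, h2, h3, h4⟩ h
  filter_upwards [eventually_countable_forall.2 hX.residual_finite_orbit, h2] with f hf1 hf2
  exact ⟨hf1, fun A B g h1 h2 h3 => hf2 ⟨A, B, B.image fun b => (b, g b)⟩ g h1 h2 h3 rfl⟩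

end Topology

theorem mainTheorem5 {X : Type*} [MetricSpace X] (hX : IsRationalUrysohn X) :
    (∃ f : X ≃ᵢ X, IsGenericIsometry f) ∧
    ∀ f : X ≃ᵢ X, IsGenericIsometry f → ∀ n : ℤ, n ≠ 0 →
      (∃ g : X ≃ᵢ X, g ^ n = f) ∧ IsConj f (f ^ n) := by
  have := hX.countable
  let _ : TopologicalSpace (X ≃ᵢ X) := permutationTopology X
  have _ := baireSpace_permutationTopology X
  have hrich := hX.residual_isRichIsometry
  refine ⟨?_, fun f hf n hn => ?_⟩
  · obtain ⟨f, hf⟩ := (dense_of_mem_residual hrich).nonempty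
    exact ⟨f, Filter.mem_of_superset hrich fun g hg => hf.isConj hX hg⟩
  · obtain ⟨h, hfh, hh⟩ := (dense_of_mem_residual (Filter.inter_mem hf hrich)).nonempty
    obtain ⟨c, rfl⟩ := isConj_iff.1 hfh
    have hpow : IsConj f ((c * f * c⁻¹) ^ n) :=
      hfh.trans (IsRichIsometry.isConj hX hh (IsRichIsometry.zpow hX hh hn))
    have hconj : IsConj f (f ^ n) :=
      hpow.trans (isConj_iff.2 ⟨c⁻¹, by rw [conj_zpow]; group⟩)
    obtain ⟨d, hd⟩ := isConj_iff.1 hconj.symm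
    exact ⟨⟨d * f * d⁻¹, by rw [conj_zpow, hd]⟩, hconj⟩
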